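/- For $\beta>1$ let $f_\beta(x)=\beta x \pmod 1$, and let $\lfloor\beta\rfloor$ denote the largest integer strictly smaller than $\beta$. For $x\in[0,1)$ let $d(x,\beta)=(d_n)_{n\ge 0}\in\{0,\dots,\lfloor\beta\rfloor\}^{\mathbb N}$, where $d_n$ is the integer part of $\beta f_\beta^n(x)$. Let the $\beta$-shift $S_\beta$ be the closure of $\{d(x,\beta):x\in[0,1)\}$ in the product topology, and put $\pi_\beta((i_k)_{k\ge0})=\sum_{k\ge0} i_k\beta^{-(k+1)}$. For $E\subset\mathbb R$ let \[ G_{f_\beta}(E)=\Big\{\,y\in[0,1) : E\cap\overline{\{f_\beta^n(y):n\ge1\}}=\emptyset\,\Big\}, \] where the closure is taken in $\mathbb R$. Let $N\in\mathbb N$ and $\beta_1,\dots,\beta_N>1$. For each $1\le n\le N$ let $\Sigma_{A_n}\subset S_{\beta_n}$ be a one-sided subshift of finite type over the alphabet $\{0,\dots,\lfloor\beta_n\rfloor\}$ (the set of all sequences avoiding some finite set of forbidden words), and suppose that there is a finite word that occurs in some sequence of $S_{\beta_n}$ but in no sequence of $\Sigma_{A_n}$. Then the set \[ \bigcap_{n=1}^N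 G_{f_{\beta_n}}\big(\pi_{\beta_n}(\Sigma_{A_n})\big) \] has Hausdorff dimension $1$. -/

import Mathlib

open Set SymbolicDynamics.FullShift

noncomputable section

namespace BetaShift

/-- The map `f_β(x) = βx mod 1`. -/
def betaMap (β x : ℝ) : ℝ := Int.fract (β * x)

/-- For `β > 1`, the largest integer strictly smaller than `β`. -/
def maxDigit (β : ℝ) : ℕ := ⌈β⌉₊ - 1

/-- The alphabet `{0, 1, …, maxDigit β}`, with the discrete topology. -/
abbrev Digit (β : ℝ) : Type := Fin (maxDigit β + 1)

/-- The `n`-th digit `[β f_β^n(x)]` of the `β`-expansion of `x`, as a natural number. -/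
def digitNat (β x : ℝ) (n : ℕ) : ℕ := ⌊β * (betaMap β)^[n] x⌋₊

theorem iterate_betaMap_mem (β : ℝ) {x : ℝ} (hx : x ∈ Ico (0 : ℝ) 1) (n : ℕ) :
    (betaMap β)^[n] x ∈ Ico (0 : ℝ) 1 := by
  cases n with
  | zero => simpa using hx
  | succ n =>
    rw [Function.iterate_succ_apply']
    exact ⟨Int.fract_nonneg _, Int.fract_lt_one _⟩

theorem digitNat_lt (β : ℝ) {x : ℝ} (hx : x ∈ Ico (0 : ℝ) 1) (n : ℕ) :
    digitNat β x n < maxDigit β + 1 := by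
  obtain ⟨h0, h1⟩ := iterate_betaMap_mem β hx n
  unfold digitNat maxDigit
  rcases le_or_gt β 0 with hβ | hβ
  · rw [Nat.floor_of_nonpos (mul_nonpos_of_nonpos_of_nonneg hβ h0)]
    exact Nat.succ_pos _
  · have h2 : ⌊β * (betaMap β)^[n] x⌋₊ < ⌈β⌉₊ := by
      rw [Nat.floor_lt (mul_nonneg hβ.le h0)]
      exact lt_of_lt_of_le (by nlinarith) (Nat.le_ceil β)
    omega

/-- The `β`-expansion `d(x, β)` of `x ∈ [0, 1)`. -/
def expansion (β : ℝ) (x : Ico (0 : ℝ) 1) : ℕ → Digit β :=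
  fun n => ⟨digitNat β x n, digitNat_lt β x.2 n⟩

/-- The `β`-shift `S_β`: the closure, in the product topology, of `{d(x, β) : x ∈ [0, 1)}`. -/
def betaShift (β : ℝ) : Set (ℕ → Digit β) := closure (range (expansion β))

/-- The projection `π_β((i_k)) = ∑ i_k / β^(k+1)`. -/
def proj (β : ℝ) (s : ℕ → Digit β) : ℝ := ∑' k : ℕ, ((s k : ℕ) : ℝ) / β ^ (k + 1)

/-- A one-sided subshift is of finite type if it consists of all sequences that avoid
some finite set of forbidden finite patterns. -/
def IsFiniteType {A : Type*} [TopologicalSpace A] [DiscreteTopology A] [Inhabited A]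
    (X : Subshift A ℕ) : Prop :=
  ∃ F : Set (Pattern A ℕ), F.Finite ∧ X = Subshift.ofForbidden F

/-- The set `X^*` of all finite words that occur in some sequence of `X`. -/
def words {A : Type*} (X : Set (ℕ → A)) : Set (List A) :=
  {w | ∃ s ∈ X, ∃ m : ℕ, ∀ (i : ℕ) (hi : i < w.length), s (m + i) = w[i]}

/-- `G_{f_β}(E)`: the points `y ∈ [0, 1)` for which the closure of `{f_β^n(y) : n ≥ 1}`
is disjoint from `E`. -/
def avoiding (β : ℝ) (E : Set ℝ) : Set ℝ :=
  {y | y ∈ Ico (0 : ℝ) 1 ∧ E ∩ closure {z | ∃ n : ℕ, 1 ≤ n ∧ z = (betaMap β)^[n] y} = ∅}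

end BetaShift

end

/-!
Fix `s < 1`. Points of the intersection are found by a removal process on the dyadic intervals of
`[0, 1]`: an interval is discarded as soon as it meets a set of points whose orbit, under one of the
maps, comes too close to the set to be avoided at a time when the map has expanded intervals of an
earlier level `m` to a fixed length `θ`. If each surviving interval of level `m` loses at most `R`
subintervals of level `m + k`, where `R` is small in comparison with `2 ^ (s * k)`, the number of
survivors grows by a factor of at least `2 ^ s` per level (`survivors_growth`). As this leaves a
margin, a cover of the resulting set with small `s`-dimensional weight can be discarded as well, and
some point still survives; hence the dimension is at least `s` (`le_dimH_of_rules`). Several maps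
only add further removal rules, and intersections need no extra argument.

For one map, two rules are used (`exists_rules`). The first keeps orbits away from the discontinuity
`0 = 1` of the circle. An interval that satisfies it lies on a single branch of the iterates up to
a bounded number of steps before the current time
(`sameBranch_of_disjoint_forbidden`), and for `θ` small those last steps have at most one
discontinuity on it (`exists_two_branches`), so that there are at most two branches in all. The
second rule keeps orbits at a positive distance from the projection `K` of the subshift, and the
preceding bound reduces its cost to the number of intervals of length `δ` needed to cover `K`. This
cost is small enough because the box dimension of `K` is less than `1`.

The bound on the box dimension (`exists_isCoveredBy_proj`) uses only that the subshift lies in the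
`β`-shift and omits one of its words. That word defines a cylinder `H`. The set of points whose
orbit misses `H` is null: every cylinder is mapped affinely by some iterate onto an interval
`[0, c)`, which contains a copy `β ^ (-k) * H` of `H` in a fixed proportion, so the set fills at
most a fixed proportion `κ < 1` of every cylinder (`tendsto_volume_missingUpTo`). At most one of the
subcylinders of a cylinder fails to be full, so the number of words of length `n` missing `H` is
controlled by the measure of the points missing `H` and is `o(β ^ n)`
(`ncard_missingWords_succ_le`). Some `q` thus has fewer than `β ^ q` such words
(`exists_ncard_missingWords_lt`), and submultiplicativity turns this into an exponential bound.
-/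

noncomputable section

namespace BetaShift

/-! ### Dyadic intervals and covers by short intervals -/

/-- The closed dyadic interval `[i / 2 ^ j, (i + 1) / 2 ^ j]` of level `j`. -/
def dyadic (j i : ℕ) : Set ℝ := Icc ((i : ℝ) / 2 ^ j) (((i : ℝ) + 1) / 2 ^ j)

theorem dyadic_add_subset (j k i : ℕ) : dyadic (j + k) i ⊆ dyadic j (i / 2 ^ k) := by
  have h2j : (0 : ℝ) < 2 ^ j := by positivity
  have h2k : (0 : ℝ) < 2 ^ k := by positivity
  have h1 : (((i / 2 ^ k : ℕ) : ℝ)) * 2 ^ k ≤ i := by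
    exact_mod_cast Nat.div_mul_le_self i (2 ^ k)
  have h2 : (i : ℝ) + 1 ≤ (((i / 2 ^ k : ℕ) : ℝ) + 1) * 2 ^ k := by
    have := Nat.lt_div_mul_add (a := i) (b := 2 ^ k) (by positivity)
    have h3 : i + 1 ≤ (i / 2 ^ k + 1) * 2 ^ k := by rw [add_mul, one_mul]; omega
    exact_mod_cast h3
  apply Icc_subset_Icc
  · rw [div_le_div_iff₀ h2j (by positivity), pow_add]
    nlinarith
  · rw [div_le_div_iff₀ (by positivity) h2j, pow_add]
    nlinarith

/-- `S` is covered by at most `M` closed intervals of length `h`. -/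
def IsCoveredBy (S : Set ℝ) (M h : ℝ) : Prop :=
  ∃ P : Finset ℝ, (P.card : ℝ) ≤ M ∧ ∀ x ∈ S, ∃ p ∈ P, x ∈ Icc p (p + h)

theorem IsCoveredBy.mono {S S' : Set ℝ} {M M' h h' : ℝ} (H : IsCoveredBy S M h) (hS : S' ⊆ S)
    (hM : M ≤ M') (hh : h ≤ h') : IsCoveredBy S' M' h' := by
  obtain ⟨P, hP, hc⟩ := H
  refine ⟨P, hP.trans hM, fun x hx => ?_⟩
  obtain ⟨p, hp, h1, h2⟩ := hc x (hS hx)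
  exact ⟨p, hp, h1, by linarith⟩

theorem IsCoveredBy.union {S S' : Set ℝ} {M M' h : ℝ} (H : IsCoveredBy S M h)
    (H' : IsCoveredBy S' M' h) : IsCoveredBy (S ∪ S') (M + M') h := by
  classical
  obtain ⟨P, hP, hc⟩ := H
  obtain ⟨P', hP', hc'⟩ := H'
  refine ⟨P ∪ P', ?_, ?_⟩
  · have : ((P ∪ P').card : ℝ) ≤ P.card + P'.card := by exact_mod_cast Finset.card_union_le P P'
    linarith
  · rintro x (hx | hx)
    · obtain ⟨p, hp, h⟩ := hc x hx
      exact ⟨p, Finset.mem_union_left _ hp, h⟩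
    · obtain ⟨p, hp, h⟩ := hc' x hx
      exact ⟨p, Finset.mem_union_right _ hp, h⟩

theorem IsCoveredBy.biUnion {α : Type*} (F : Finset α) {S : α → Set ℝ} {M h : ℝ}
    (H : ∀ a ∈ F, IsCoveredBy (S a) M h) : IsCoveredBy (⋃ a ∈ F, S a) (F.card * M) h := by
  classical
  induction F using Finset.induction_on with
  | empty => exact ⟨∅, by simp, by simp⟩
  | insert a F ha ih =>
    rw [Finset.set_biUnion_insert, Finset.card_insert_of_notMem ha]
    refine ((H a (Finset.mem_insert_self _ _)).union
      (ih fun b hb => H b (Finset.mem_insert_of_mem hb))).mono le_rfl ?_ le_rfl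
    push_cast
    linarith

theorem isCoveredBy_Icc (a h : ℝ) : IsCoveredBy (Icc a (a + h)) 1 h :=
  ⟨{a}, by simp, fun x hx => ⟨a, by simp, hx⟩⟩

theorem card_le_of_natCast_mem_Icc (F : Finset ℕ) {a b : ℝ} (hab : a ≤ b + 1)
    (hF : ∀ i ∈ F, (i : ℝ) ∈ Icc a b) : (F.card : ℝ) ≤ b - a + 1 := by
  have h1 : F.image (fun i : ℕ => (i : ℤ)) ⊆ Finset.Icc ⌈a⌉ ⌊b⌋ := by
    intro z hz
    obtain ⟨i, hi, rfl⟩ := Finset.mem_image.1 hz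
    obtain ⟨h1, h2⟩ := hF i hi
    rw [Finset.mem_Icc]
    exact ⟨Int.ceil_le.2 (by exact_mod_cast h1), Int.le_floor.2 (by exact_mod_cast h2)⟩
  have h2 := Finset.card_le_card h1
  rw [Finset.card_image_of_injective _ Nat.cast_injective, Int.card_Icc] at h2
  have h3 : (F.card : ℝ) ≤ ((⌊b⌋ + 1 - ⌈a⌉).toNat : ℝ) := by exact_mod_cast h2
  refine h3.trans ?_
  rcases le_total 0 (⌊b⌋ + 1 - ⌈a⌉) with h | h
  · have h4 : (((⌊b⌋ + 1 - ⌈a⌉).toNat : ℤ) : ℝ) = ((⌊b⌋ + 1 - ⌈a⌉ : ℤ) : ℝ) := by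
      rw [Int.toNat_of_nonneg h]
    rw [Int.cast_natCast] at h4
    rw [h4]
    push_cast
    linarith [Int.floor_le b, Int.le_ceil a]
  · rw [Int.toNat_of_nonpos h]
    simp only [Nat.cast_zero]
    linarith

/-- Few dyadic intervals of level `j` meet a set covered by few short intervals. -/
theorem IsCoveredBy.card_dyadic_le {S : Set ℝ} {M h : ℝ} (H : IsCoveredBy S M h) (hh : 0 ≤ h)
    (j : ℕ) (F : Finset ℕ) (hF : ∀ i ∈ F, (dyadic j i ∩ S).Nonempty) :
    (F.card : ℝ) ≤ M * (h * 2 ^ j + 2) := by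
  classical
  obtain ⟨P, hP, hc⟩ := H
  have h2j : (0 : ℝ) < 2 ^ j := by positivity
  have hsub : F ⊆ P.biUnion fun p => F.filter fun i => (dyadic j i ∩ Icc p (p + h)).Nonempty := by
    intro i hi
    obtain ⟨x, hx, hxS⟩ := hF i hi
    obtain ⟨p, hp, hxp⟩ := hc x hxS
    exact Finset.mem_biUnion.2 ⟨p, hp, Finset.mem_filter.2 ⟨hi, x, hx, hxp⟩⟩
  have h1 : (F.card : ℝ) ≤ ∑ p ∈ P, ((F.filter fun i =>
      (dyadic j i ∩ Icc p (p + h)).Nonempty).card : ℝ) := by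
    exact_mod_cast (Finset.card_le_card hsub).trans Finset.card_biUnion_le
  have h2 : ∀ p ∈ P, ((F.filter fun i =>
      (dyadic j i ∩ Icc p (p + h)).Nonempty).card : ℝ) ≤ h * 2 ^ j + 2 := by
    intro p _
    have hnn : 0 ≤ h * 2 ^ j := by positivity
    refine (card_le_of_natCast_mem_Icc (a := p * 2 ^ j - 1) (b := (p + h) * 2 ^ j) _
      (by nlinarith) ?_).trans (by linarith)
    intro i hi
    obtain ⟨x, ⟨hx1, hx2⟩, hx3, hx4⟩ := (Finset.mem_filter.1 hi).2
    rw [div_le_iff₀ h2j] at hx1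
    rw [le_div_iff₀ h2j] at hx2
    constructor <;> nlinarith
  calc (F.card : ℝ) ≤ _ := h1
    _ ≤ ∑ p ∈ P, (h * 2 ^ j + 2) := Finset.sum_le_sum h2
    _ = P.card * (h * 2 ^ j + 2) := by rw [Finset.sum_const, nsmul_eq_mul]
    _ ≤ M * (h * 2 ^ j + 2) := by gcongr

/-! ### Counting the dyadic intervals that survive a removal process -/

/-- The indices of the two halves of the dyadic intervals with index in `s`. -/
def children (s : Finset ℕ) : Finset ℕ := s.image (fun i => 2 * i) ∪ s.image fun i => 2 * i + 1

theorem mem_children {s : Finset ℕ} {i : ℕ} : i ∈ children s ↔ i / 2 ∈ s := by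
  unfold children
  simp only [Finset.mem_union, Finset.mem_image]
  constructor
  · rintro (⟨a, ha, rfl⟩ | ⟨a, ha, rfl⟩)
    · rwa [show 2 * a / 2 = a by omega]
    · rwa [show (2 * a + 1) / 2 = a by omega]
  · intro h
    rcases Nat.even_or_odd' i with ⟨c, hc | hc⟩
    · exact Or.inl ⟨i / 2, h, by omega⟩
    · exact Or.inr ⟨i / 2, h, by omega⟩

theorem card_children (s : Finset ℕ) : (children s).card = 2 * s.card := by
  unfold children
  rw [Finset.card_union_of_disjoint, Finset.card_image_of_injective _ fun a b h => by grind,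
    Finset.card_image_of_injective _ fun a b h => by grind, two_mul]
  rw [Finset.disjoint_left]
  intro a ha hb
  obtain ⟨x, -, rfl⟩ := Finset.mem_image.1 ha
  obtain ⟨y, -, hy⟩ := Finset.mem_image.1 hb
  omega

open Classical in
/-- The level-`j` dyadic subintervals of `[0, 1]` that remain when, level by level, the intervals
`(j, i)` with `Rem j i` are removed together with all that they contain. The interval `[0, 1]`
itself is kept in any case. -/
def survivors (Rem : ℕ → ℕ → Prop) : ℕ → Finset ℕ
  | 0 => {0}
  | j + 1 => (children (survivors Rem j)).filter fun i => ¬ Rem (j + 1) i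

theorem survivors_ancestor (Rem : ℕ → ℕ → Prop) (j k i : ℕ) (hi : i ∈ survivors Rem (j + k)) :
    i / 2 ^ k ∈ survivors Rem j := by
  classical
  induction k generalizing i with
  | zero => simpa using hi
  | succ k ih =>
    rw [← add_assoc, survivors, Finset.mem_filter, mem_children] at hi
    have := ih _ hi.1
    rwa [Nat.div_div_eq_div_mul, ← pow_succ'] at this

theorem not_rem_of_mem_survivors {Rem : ℕ → ℕ → Prop} {j i : ℕ} (hj : 1 ≤ j)
    (hi : i ∈ survivors Rem j) : ¬ Rem j i := by
  classical
  obtain ⟨j, rfl⟩ := Nat.exists_eq_add_of_le' hj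
  rw [survivors, Finset.mem_filter] at hi
  exact hi.2

theorem lt_of_mem_survivors {Rem : ℕ → ℕ → Prop} {j i : ℕ} (hi : i ∈ survivors Rem j) :
    i < 2 ^ j := by
  have := survivors_ancestor Rem 0 j i (by simpa using hi)
  rw [survivors, Finset.mem_singleton, Nat.div_eq_zero_iff] at this
  simpa using this

open Classical in
/-- If the number of intervals removed at level `j + 1` is controlled by the numbers of survivors
of earlier levels and by an exponentially small part of the total, the survivors grow
exponentially: each earlier number of survivors is, inductively, small compared with the
present one. -/
theorem survivors_growth {ι : Type*} [Fintype ι] (Rem : ℕ → ℕ → Prop) (k : ι → ℕ)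
    (hk : ∀ r, 1 ≤ k r) (R : ι → ℝ) (hR0 : ∀ r, 0 ≤ R r) (lam c : ℝ) (hlam : 0 < lam) (hc : 0 ≤ c)
    (hsum : ∑ r, R r * lam / lam ^ k r + c ≤ 2 - lam)
    (hcount : ∀ j, (((children (survivors Rem j)).filter fun i => Rem (j + 1) i).card : ℝ) ≤
      ∑ r, (if k r ≤ j + 1 then R r * (survivors Rem (j + 1 - k r)).card else 0) + c * lam ^ j)
    (j : ℕ) : lam ^ j ≤ (survivors Rem j).card ∧
      ∀ i ≤ j, lam ^ i * (survivors Rem (j - i)).card ≤ (survivors Rem j).card := by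
  induction j with
  | zero => simp [survivors]
  | succ j ih =>
    set t : ℕ → ℝ := fun j => ((survivors Rem j).card : ℝ) with ht
    have hstep : lam * t j ≤ t (j + 1) := by
      have h1 : t (j + 1) + (((children (survivors Rem j)).filter
          fun i => Rem (j + 1) i).card : ℝ) = 2 * t j := by
        have := Finset.card_filter_add_card_filter_not (s := children (survivors Rem j))
          (fun i => Rem (j + 1) i)
        rw [card_children] at this
        simp only [ht, survivors]
        have h' : (((children (survivors Rem j)).filter fun i => Rem (j + 1) i).card : ℝ) +
          ((children (survivors Rem j)).filter fun i => ¬ Rem (j + 1) i).card =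
            2 * (survivors Rem j).card := by exact_mod_cast this
        linarith
      have h2 : ∑ r, (if k r ≤ j + 1 then R r * t (j + 1 - k r) else 0) ≤
          ∑ r, R r * lam / lam ^ k r * t j := by
        apply Finset.sum_le_sum
        intro r _
        have htj : 0 ≤ t j := Nat.cast_nonneg _
        split_ifs with h
        · obtain ⟨k', hk'⟩ := Nat.exists_eq_add_of_le' (hk r)
          have h3 := ih.2 k' (by omega)
          have h4 : j + 1 - k r = j - k' := by omega
          rw [h4, mul_div_assoc, mul_assoc]
          apply mul_le_mul_of_nonneg_left _ (hR0 r)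
          rw [hk', pow_succ, div_mul_eq_mul_div, le_div_iff₀ (by positivity)]
          calc t (j - k') * (lam ^ k' * lam) = lam * (lam ^ k' * t (j - k')) := by ring
            _ ≤ lam * t j := by gcongr
        · have := hR0 r
          positivity
      rw [← Finset.sum_mul] at h2
      have h3 := hcount j
      have h4 : c * lam ^ j ≤ c * t j := by gcongr; exact ih.1
      have h5 : (∑ r, R r * lam / lam ^ k r + c) * t j ≤ (2 - lam) * t j := by
        gcongr
      nlinarith
    refine ⟨?_, ?_⟩
    · calc lam ^ (j + 1) = lam * lam ^ j := by ring
        _ ≤ lam * t j := by gcongr; exact ih.1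
        _ ≤ _ := hstep
    · intro i hi
      rcases Nat.eq_zero_or_pos i with rfl | hi0
      · simp
      · obtain ⟨i, rfl⟩ := Nat.exists_eq_add_of_le' hi0
        have h6 := ih.2 i (by omega)
        rw [show j + 1 - (i + 1) = j - i by omega]
        calc lam ^ (i + 1) * ((survivors Rem (j - i)).card : ℝ)
            = lam * (lam ^ i * (survivors Rem (j - i)).card) := by ring
          _ ≤ lam * t j := by gcongr
          _ ≤ _ := hstep

/-- If every level of a removal process has survivors, some point of `[0, 1]` lies in a surviving
interval of every level. -/
theorem exists_mem_survivors (Rem : ℕ → ℕ → Prop) (hne : ∀ j, (survivors Rem j).Nonempty) :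
    ∃ y ∈ Icc (0 : ℝ) 1, ∀ j, ∃ i ∈ survivors Rem j, y ∈ dyadic j i := by
  have hmono : ∀ j, (⋃ i ∈ survivors Rem (j + 1), dyadic (j + 1) i) ⊆
      ⋃ i ∈ survivors Rem j, dyadic j i := by
    intro j y hy
    simp only [mem_iUnion] at hy ⊢
    obtain ⟨i, hi, hy⟩ := hy
    exact ⟨i / 2 ^ 1, survivors_ancestor Rem j 1 i hi, dyadic_add_subset j 1 i hy⟩
  have hcomp : ∀ j, IsCompact (⋃ i ∈ survivors Rem j, dyadic j i) := fun j =>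
    (survivors Rem j).isCompact_biUnion fun i _ => isCompact_Icc
  have hne' : ∀ j, (⋃ i ∈ survivors Rem j, dyadic j i).Nonempty := by
    intro j
    obtain ⟨i, hi⟩ := hne j
    refine ⟨(i : ℝ) / 2 ^ j, ?_⟩
    simp only [mem_iUnion]
    refine ⟨i, hi, le_rfl, ?_⟩
    gcongr
    exact le_add_of_nonneg_right zero_le_one
  obtain ⟨y, hy⟩ := IsCompact.nonempty_iInter_of_sequence_nonempty_isCompact_isClosed
    (fun j => ⋃ i ∈ survivors Rem j, dyadic j i) hmono hne' (hcomp 0) fun j => (hcomp j).isClosed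
  have h : ∀ j, ∃ i ∈ survivors Rem j, y ∈ dyadic j i := by
    intro j
    simpa only [mem_iUnion, exists_prop] using mem_iInter.1 hy j
  refine ⟨y, ?_, h⟩
  obtain ⟨i, hi, hy0⟩ := h 0
  rw [survivors, Finset.mem_singleton] at hi
  subst hi
  simpa [dyadic] using hy0

/-! ### A lower bound for the Hausdorff dimension -/

open MeasureTheory Metric in
/-- A set of vanishing `s`-dimensional Hausdorff measure has a cover by sets of dyadic size,
with arbitrarily small total `s`-weight. -/
theorem exists_dyadic_cover {E : Set ℝ} {s : ℝ} (hs : 0 < s)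
    (hE : Measure.hausdorffMeasure s E = 0) {σ : ℝ} (hσ : 0 < σ) :
    ∃ (t : ℕ → Set ℝ) (l : ℕ → ℕ), E ⊆ ⋃ n, t n ∧ (∀ n, 1 ≤ l n) ∧
      (∀ n, IsCoveredBy (t n) 1 (2 ^ l n)⁻¹) ∧
      ∀ F : Finset ℕ, ∑ n ∈ F, (((2 : ℝ) ^ s)⁻¹) ^ l n ≤ σ := by
  set y : ℝ := ((2 : ℝ) ^ s)⁻¹ with hy
  have hlam1 : (1 : ℝ) < 2 ^ s := Real.one_lt_rpow (by norm_num) hs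
  have hy0 : 0 < y := by positivity
  have hy1 : y < 1 := inv_lt_one_of_one_lt₀ hlam1
  obtain ⟨σ', hσ'0, hσ'1, hσ'2⟩ : ∃ σ' > 0, 2 * σ' ≤ y ∧ 2 * σ' ≤ y * σ := by
    refine ⟨min y (y * σ) / 2, by positivity, ?_, ?_⟩
    · linarith [min_le_left y (y * σ)]
    · linarith [min_le_right y (y * σ)]
  rw [Measure.hausdorffMeasure_apply] at hE
  have h1 := ENNReal.iSup_eq_zero.1 hE 1
  have h2 := ENNReal.iSup_eq_zero.1 h1 one_pos
  have h3 : (⨅ (t : ℕ → Set ℝ) (_ : E ⊆ ⋃ n, t n) (_ : ∀ n, ediam (t n) ≤ 1),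
      ∑' n, ⨆ _ : (t n).Nonempty, ediam (t n) ^ s) < ENNReal.ofReal σ' := by
    rw [h2]
    simpa using hσ'0
  simp only [iInf_lt_iff] at h3
  obtain ⟨t, htE, htd, hts⟩ := h3
  have h4 : ∀ n, (⨆ _ : (t n).Nonempty, ediam (t n) ^ s) = ediam (t n) ^ s := by
    intro n
    rcases (t n).eq_empty_or_nonempty with h | h
    · simp [h, hs]
    · simp [h]
  simp only [h4] at hts
  set D : ℕ → ℝ := fun n => (ediam (t n)).toReal with hD
  have hDtop : ∀ n, ediam (t n) ≠ ⊤ := fun n => ne_top_of_le_ne_top ENNReal.one_ne_top (htd n)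
  have h5 : ∀ F : Finset ℕ, ∑ n ∈ F, D n ^ s ≤ σ' := by
    intro F
    have h6 : ∑ n ∈ F, ediam (t n) ^ s ≤ ENNReal.ofReal σ' :=
      (ENNReal.sum_le_tsum F).trans hts.le
    have h7 : ∑ n ∈ F, D n ^ s = (∑ n ∈ F, ediam (t n) ^ s).toReal := by
      rw [ENNReal.toReal_sum fun n _ => ENNReal.rpow_ne_top_of_nonneg hs.le (hDtop n)]
      exact Finset.sum_congr rfl fun n _ => by rw [ENNReal.toReal_rpow]
    rw [h7]
    exact ENNReal.toReal_le_of_le_ofReal hσ'0.le h6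
  -- The summand `σ' * 2⁻¹ ^ (n + 1)` gives a positive size to sets of diameter zero.
  set x : ℕ → ℝ := fun n => D n ^ s + σ' * (1 / 2) ^ (n + 1) with hx
  have hDn : ∀ n, 0 ≤ D n := fun n => ENNReal.toReal_nonneg
  have hx0 : ∀ n, 0 < x n := fun n =>
    add_pos_of_nonneg_of_pos (Real.rpow_nonneg (hDn n) s) (by positivity)
  have hxF : ∀ F : Finset ℕ, ∑ n ∈ F, x n ≤ 2 * σ' := by
    intro F
    have h8 : ∑ n ∈ F, σ' * (1 / 2 : ℝ) ^ (n + 1) ≤ σ' := by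
      have h9 : ∑ n ∈ F, (1 / 2 : ℝ) ^ n ≤ 2 := by
        exact (summable_geometric_two.sum_le_tsum F fun n _ => by positivity).trans_eq
          tsum_geometric_two
      calc ∑ n ∈ F, σ' * (1 / 2 : ℝ) ^ (n + 1) = σ' / 2 * ∑ n ∈ F, (1 / 2 : ℝ) ^ n := by
            rw [Finset.mul_sum]
            exact Finset.sum_congr rfl fun n _ => by ring
        _ ≤ σ' / 2 * 2 := by gcongr
        _ = σ' := by ring
    rw [Finset.sum_add_distrib]
    linarith [h5 F]
  have hxy : ∀ n, x n ≤ y := fun n => by simpa using (hxF {n}).trans hσ'1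
  choose l hl1 hl2 using fun n =>
    exists_nat_pow_near_of_lt_one (hx0 n) ((hxy n).trans hy1.le) hy0 hy1
  refine ⟨t, l, htE, ?_, ?_, ?_⟩
  · intro n
    by_contra h
    have h0 : l n = 0 := by omega
    have := hl1 n
    rw [h0, zero_add, pow_one] at this
    linarith [hxy n]
  · intro n
    have h10 : D n ≤ (2 ^ l n)⁻¹ := by
      have h11 : D n ^ s ≤ ((2 ^ l n)⁻¹ : ℝ) ^ s := by
        calc D n ^ s ≤ x n := le_add_of_nonneg_right (by positivity)
          _ ≤ y ^ l n := hl2 n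
          _ = ((2 ^ l n)⁻¹ : ℝ) ^ s := by
            rw [hy, Real.inv_rpow (by positivity), inv_pow, ← Real.rpow_natCast,
              ← Real.rpow_mul (by norm_num), ← Real.rpow_natCast 2 (l n),
              ← Real.rpow_mul (by norm_num), mul_comm]
      exact (Real.rpow_le_rpow_iff (hDn n) (by positivity) hs).1 h11
    rcases (t n).eq_empty_or_nonempty with h | h
    · exact ⟨∅, by simp, by simp [h]⟩
    · have h12 : ∀ a ∈ t n, ∀ b ∈ t n, b - (2 ^ l n)⁻¹ ≤ a := by
        intro a ha b hb
        have h13 := edist_le_ediam_of_mem ha hb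
        have h14 : dist a b ≤ D n := by
          rw [dist_edist]
          exact ENNReal.toReal_mono (hDtop n) h13
        rw [Real.dist_eq] at h14
        linarith [neg_abs_le (a - b)]
      refine (isCoveredBy_Icc (sInf (t n)) _).mono (fun b hb => ⟨?_, ?_⟩) le_rfl le_rfl
      · exact csInf_le ⟨b - (2 ^ l n)⁻¹, fun a ha => h12 a ha b hb⟩ hb
      · linarith [le_csInf h fun a ha => h12 a ha b hb]
  · intro F
    have h15 : ∑ n ∈ F, y ^ l n * y ≤ y * σ := by
      refine (Finset.sum_le_sum fun n _ => ?_).trans ((hxF F).trans hσ'2)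
      rw [← pow_succ]
      exact (hl1 n).le
    rw [← Finset.sum_mul, mul_comm] at h15
    exact le_of_mul_le_mul_left h15 hy0

/-- Suppose that each rule `r` forbids sets `B r m`, and that a dyadic interval of level `m` which
meets none of the sets forbidden up to that level has at most `R r` subintervals of level
`m + k r` that meet `B r m`. If the `R r` are small in comparison with `2 ^ (s * k r)`, the points
in no forbidden set form a set of dimension at least `s`. For, a cover of total `s`-weight close
to zero may be treated as a further family of removed intervals, and still leaves survivors. -/
theorem le_dimH_of_rules {ι : Type*} [Fintype ι] (k : ι → ℕ) (hk : ∀ r, 1 ≤ k r) (R : ι → ℝ)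
    (hR0 : ∀ r, 0 ≤ R r) (B : ι → ℕ → Set ℝ) {s : NNReal} (hs : 0 < s)
    (hsum : ∑ r, R r * (2 : ℝ) ^ (s : ℝ) / ((2 : ℝ) ^ (s : ℝ)) ^ k r < 2 - 2 ^ (s : ℝ))
    (hcount : ∀ r m i, i < 2 ^ m →
      (∀ r' m', m' + k r' ≤ m → Disjoint (dyadic m i) (B r' m')) → ∀ F : Finset ℕ,
      (∀ i' ∈ F, i' / 2 ^ k r = i ∧ (dyadic (m + k r) i' ∩ B r m).Nonempty) →
      (F.card : ℝ) ≤ R r) :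
    (s : ENNReal) ≤ dimH {y | y ∈ Icc (0 : ℝ) 1 ∧ ∀ r m, y ∉ B r m} := by
  classical
  apply le_dimH_of_hausdorffMeasure_ne_zero
  intro hE
  set lam : ℝ := (2 : ℝ) ^ (s : ℝ) with hlam
  have hlam0 : 0 < lam := by positivity
  set σ : ℝ := (2 - lam - ∑ r, R r * lam / lam ^ k r) / (3 * lam) with hσ
  have hσ0 : 0 < σ := div_pos (by linarith) (by positivity)
  obtain ⟨t, l, htE, hl1, htl, htF⟩ := exists_dyadic_cover (by exact_mod_cast hs) hE hσ0
  rw [← hlam] at htF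
  obtain ⟨Rem, hRem⟩ : ∃ Rem : ℕ → ℕ → Prop, Rem = fun j i =>
    (∃ r m, m + k r = j ∧ (dyadic j i ∩ B r m).Nonempty) ∨
      ∃ n, l n = j ∧ (dyadic j i ∩ t n).Nonempty := ⟨_, rfl⟩
  have hdisj : ∀ j, ∀ i ∈ survivors Rem j, ∀ r m, m + k r ≤ j →
      Disjoint (dyadic j i) (B r m) := by
    intro j i hi r m hm
    obtain ⟨d, rfl⟩ := Nat.exists_eq_add_of_le hm
    have h1 := not_rem_of_mem_survivors (by have := hk r; omega)
      (survivors_ancestor Rem (m + k r) d i hi)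
    rw [hRem] at h1
    simp only [not_or, not_exists, not_and] at h1
    have h2 := h1.1 r m rfl
    rw [not_nonempty_iff_eq_empty, ← disjoint_iff_inter_eq_empty] at h2
    exact h2.mono_left (dyadic_add_subset _ _ _)
  have hfew : ∀ j, ∀ F : Finset ℕ, (∀ n ∈ F, l n = j) → (F.card : ℝ) ≤ σ * lam ^ j := by
    intro j F hF
    have h1 := htF F
    rw [Finset.sum_congr rfl fun n hn => by rw [hF n hn], Finset.sum_const, nsmul_eq_mul,
      inv_pow, ← div_eq_mul_inv, div_le_iff₀ (by positivity)] at h1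
    exact h1
  have hfin : ∀ j, {n | l n = j}.Finite := by
    intro j
    by_contra h
    obtain ⟨N, hN⟩ := exists_nat_gt (σ * lam ^ j)
    obtain ⟨F, hF, hFN⟩ := Set.Infinite.exists_subset_card_eq h N
    have := hfew j F fun n hn => hF hn
    rw [hFN] at this
    linarith
  have hgrow := survivors_growth Rem k hk R hR0 lam (3 * σ * lam) hlam0 (by positivity) (by
    have h : 3 * σ * lam = 2 - lam - ∑ r, R r * lam / lam ^ k r := by
      rw [hσ, mul_right_comm, mul_div_cancel₀ _ (by positivity)]
    linarith) (by
    intro j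
    set C := children (survivors Rem j) with hC
    set G : ι → Finset ℕ := fun r => if k r ≤ j + 1 then
      C.filter fun i => (dyadic (j + 1) i ∩ B r (j + 1 - k r)).Nonempty else ∅ with hG
    set H : Finset ℕ := (hfin (j + 1)).toFinset.biUnion fun n =>
      C.filter fun i => (dyadic (j + 1) i ∩ t n).Nonempty with hH
    have hsub : (C.filter fun i => Rem (j + 1) i) ⊆ Finset.univ.biUnion G ∪ H := by
      intro i hi
      rw [Finset.mem_filter, hRem] at hi
      obtain ⟨hiC, ⟨r, m, hm, hne⟩ | ⟨n, hn, hne⟩⟩ := hi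
      · refine Finset.mem_union_left _ (Finset.mem_biUnion.2 ⟨r, Finset.mem_univ _, ?_⟩)
        rw [hG]
        simp only
        rw [if_pos (by omega), show j + 1 - k r = m by omega]
        exact Finset.mem_filter.2 ⟨hiC, hne⟩
      · refine Finset.mem_union_right _ (Finset.mem_biUnion.2 ⟨n, by simpa using hn, ?_⟩)
        exact Finset.mem_filter.2 ⟨hiC, hne⟩
    have hGcard : ∀ r, ((G r).card : ℝ) ≤
        if k r ≤ j + 1 then R r * (survivors Rem (j + 1 - k r)).card else 0 := by
      intro r
      rw [hG]
      simp only
      split_ifs with h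
      · obtain ⟨m, hm⟩ := Nat.exists_eq_add_of_le' h
        rw [show j + 1 - k r = m by omega]
        obtain ⟨k', hk'⟩ := Nat.exists_eq_add_of_le' (hk r)
        have hmaps : ∀ i ∈ C.filter fun i => (dyadic (j + 1) i ∩ B r m).Nonempty,
            i / 2 ^ k r ∈ survivors Rem m := by
          intro i hi
          have h1 := mem_children.1 (Finset.mem_filter.1 hi).1
          rw [show j = m + k' by omega] at h1
          have h2 := survivors_ancestor Rem m k' _ h1
          rwa [Nat.div_div_eq_div_mul, ← pow_succ', ← hk'] at h2
        rw [Finset.card_eq_sum_card_fiberwise hmaps]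
        push_cast
        calc _ ≤ ∑ i ∈ survivors Rem m, R r := by
              refine Finset.sum_le_sum fun i hi => ?_
              refine hcount r m i (lt_of_mem_survivors hi) (fun r' m' h' => hdisj m i hi r' m' h')
                _ fun i' hi' => ?_
              rw [Finset.mem_filter, Finset.mem_filter] at hi'
              exact ⟨hi'.2, by rw [← hm]; exact hi'.1.2⟩
          _ = R r * (survivors Rem m).card := by rw [Finset.sum_const, nsmul_eq_mul, mul_comm]
      · simp
    have hHcard : (H.card : ℝ) ≤ 3 * σ * lam * lam ^ j := by
      calc (H.card : ℝ) ≤ ∑ n ∈ (hfin (j + 1)).toFinset,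
            ((C.filter fun i => (dyadic (j + 1) i ∩ t n).Nonempty).card : ℝ) := by
            exact_mod_cast Finset.card_biUnion_le
        _ ≤ ∑ n ∈ (hfin (j + 1)).toFinset, (3 : ℝ) := by
            refine Finset.sum_le_sum fun n hn => ?_
            have hn' : l n = j + 1 := by simpa using hn
            refine ((htl n).card_dyadic_le (by positivity) (j + 1) _ fun i hi =>
              (Finset.mem_filter.1 hi).2).trans ?_
            rw [hn', inv_mul_cancel₀ (by positivity)]
            norm_num
        _ = 3 * (hfin (j + 1)).toFinset.card := by
            rw [Finset.sum_const, nsmul_eq_mul, mul_comm]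
        _ ≤ 3 * (σ * lam ^ (j + 1)) := by
            gcongr
            exact hfew _ _ fun n hn => by simpa using hn
        _ = _ := by ring
    calc ((C.filter fun i => Rem (j + 1) i).card : ℝ)
        ≤ ((Finset.univ.biUnion G).card : ℝ) + H.card := by
          exact_mod_cast (Finset.card_le_card hsub).trans (Finset.card_union_le _ _)
      _ ≤ ∑ r, ((G r).card : ℝ) + H.card := by
          gcongr
          exact_mod_cast Finset.card_biUnion_le
      _ ≤ _ := by
          gcongr
          exact hGcard _)
  obtain ⟨y, hy, hyj⟩ := exists_mem_survivors Rem fun j => by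
    rw [← Finset.card_pos]
    have h1 : (0 : ℝ) < (survivors Rem j).card := lt_of_lt_of_le (by positivity) (hgrow j).1
    exact_mod_cast h1
  have hyE : y ∈ {y | y ∈ Icc (0 : ℝ) 1 ∧ ∀ r m, y ∉ B r m} := by
    refine ⟨hy, fun r m hyB => ?_⟩
    obtain ⟨i, hi, hyi⟩ := hyj (m + k r)
    exact (hdisj _ i hi r m le_rfl).le_bot ⟨hyi, hyB⟩
  obtain ⟨n, hn⟩ := mem_iUnion.1 (htE hyE)
  obtain ⟨i, hi, hyi⟩ := hyj (l n)
  exact not_rem_of_mem_survivors (hl1 n) hi (by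
    rw [hRem]
    exact Or.inr ⟨n, rfl, y, hyi, hn⟩)

/-! ### Affine branches of the iterates of the `β`-map -/

theorem iterate_betaMap_mem_Icc (β : ℝ) {x : ℝ} (hx : x ∈ Icc (0 : ℝ) 1) (n : ℕ) :
    (betaMap β)^[n] x ∈ Icc (0 : ℝ) 1 := by
  cases n with
  | zero => simpa using hx
  | succ n =>
    rw [Function.iterate_succ_apply']
    exact ⟨Int.fract_nonneg _, (Int.fract_lt_one _).le⟩

/-- The points `x` and `y` lie on the same affine branch of `f_β^n`: the increment of `f_β^n` from
`x` to `y` is that of an affine map of slope `β^n`. -/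
def SameBranch (β : ℝ) (n : ℕ) (x y : ℝ) : Prop :=
  (betaMap β)^[n] y - (betaMap β)^[n] x = β ^ n * (y - x)

theorem SameBranch.symm {β : ℝ} {n : ℕ} {x y : ℝ} (h : SameBranch β n x y) :
    SameBranch β n y x := by
  unfold SameBranch at *
  linarith

theorem SameBranch.succ {β : ℝ} {n : ℕ} {x y : ℝ} (h : SameBranch β n x y)
    (hfl : ⌊β * (betaMap β)^[n] x⌋ = ⌊β * (betaMap β)^[n] y⌋) : SameBranch β (n + 1) x y := by
  unfold SameBranch at *
  rw [Function.iterate_succ_apply', Function.iterate_succ_apply']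
  have h1 := Int.self_sub_floor (β * (betaMap β)^[n] x)
  have h2 := Int.self_sub_floor (β * (betaMap β)^[n] y)
  rw [hfl] at h1
  unfold betaMap at *
  rw [← h1, ← h2, pow_succ]
  linear_combination β * h

theorem SameBranch.comp {β : ℝ} {p q : ℕ} {x y : ℝ} (h : SameBranch β p x y)
    (h' : SameBranch β q ((betaMap β)^[p] x) ((betaMap β)^[p] y)) : SameBranch β (q + p) x y := by
  unfold SameBranch at *
  rw [Function.iterate_add_apply, Function.iterate_add_apply, h', h, pow_add]
  ring

/-- On `[0, 1]`, the branches of `f_β^n` are given by finitely many translations of `x ↦ β^n x`. -/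
theorem exists_translations {β : ℝ} (hβ : 1 < β) (n : ℕ) :
    ∃ G : Finset ℝ, ∀ x ∈ Icc (0 : ℝ) 1, β ^ n * x - (betaMap β)^[n] x ∈ G := by
  classical
  induction n with
  | zero => exact ⟨{0}, by simp⟩
  | succ n ih =>
    obtain ⟨G, hG⟩ := ih
    refine ⟨(G ×ˢ Finset.range (⌊β⌋₊ + 1)).image fun a => β * a.1 + a.2, fun x hx => ?_⟩
    rw [Finset.mem_image]
    have hm := iterate_betaMap_mem_Icc β hx n
    have hnn : 0 ≤ β * (betaMap β)^[n] x := mul_nonneg (by linarith) hm.1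
    refine ⟨(β ^ n * x - (betaMap β)^[n] x, ⌊β * (betaMap β)^[n] x⌋₊), ?_, ?_⟩
    · rw [Finset.mem_product]
      refine ⟨hG x hx, Finset.mem_range.2 (Nat.lt_succ_of_le (Nat.floor_mono ?_))⟩
      nlinarith [hm.2]
    · have h1 := Int.self_sub_floor (β * (betaMap β)^[n] x)
      have h2 := natCast_floor_eq_intCast_floor (R := ℝ) hnn
      rw [Function.iterate_succ_apply']
      unfold betaMap at *
      rw [← h1, h2, pow_succ]
      ring

/-- Finitely many points separate the affine branches of `f_β^q`, `q ≤ Q`, on `[0, 1]`. -/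
theorem exists_discontinuities {β : ℝ} (hβ : 1 < β) (Q : ℕ) :
    ∃ D : Finset ℝ, ∀ q ≤ Q, ∀ x ∈ Icc (0 : ℝ) 1, ∀ y ∈ Icc (0 : ℝ) 1, x ≤ y →
      (∀ d ∈ D, ¬ (x < d ∧ d ≤ y)) → SameBranch β q x y := by
  classical
  have hβ0 : 0 < β := by linarith
  induction Q with
  | zero =>
    refine ⟨∅, fun q hq x _ y _ _ _ => ?_⟩
    rw [Nat.le_zero.1 hq]
    simp [SameBranch]
  | succ Q ih =>
    obtain ⟨D, hD⟩ := ih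
    obtain ⟨G, hG⟩ := exists_translations hβ Q
    refine ⟨D ∪ (G ×ˢ Finset.range (⌊β⌋₊ + 1)).image fun a => (β * a.1 + a.2) / β ^ (Q + 1),
      fun q hq x hx y hy hxy hd => ?_⟩
    have hd1 : ∀ d ∈ D, ¬ (x < d ∧ d ≤ y) := fun d h => hd d (Finset.mem_union_left _ h)
    rcases Nat.le_succ_iff.1 hq with hq | rfl
    · exact hD q hq x hx y hy hxy hd1
    have hb := hD Q le_rfl x hx y hy hxy hd1
    refine hb.succ ?_
    by_contra hne
    have hmy := iterate_betaMap_mem_Icc β hy Q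
    have hle : (betaMap β)^[Q] x ≤ (betaMap β)^[Q] y := by
      have : 0 ≤ β ^ Q * (y - x) := mul_nonneg (by positivity) (by linarith)
      unfold SameBranch at hb
      linarith
    have hnny : 0 ≤ β * (betaMap β)^[Q] y := mul_nonneg hβ0.le hmy.1
    have hlt : ⌊β * (betaMap β)^[Q] x⌋ < ⌊β * (betaMap β)^[Q] y⌋ :=
      lt_of_le_of_ne (Int.floor_mono (by gcongr)) hne
    rw [Int.floor_lt] at hlt
    have h2 := natCast_floor_eq_intCast_floor (R := ℝ) hnny
    have h3 := Int.floor_le (β * (betaMap β)^[Q] y)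
    rw [← h2] at hlt h3
    refine hd ((β * (β ^ Q * y - (betaMap β)^[Q] y) + ⌊β * (betaMap β)^[Q] y⌋₊) / β ^ (Q + 1))
      (Finset.mem_union_right _ (Finset.mem_image.2
        ⟨(β ^ Q * y - (betaMap β)^[Q] y, ⌊β * (betaMap β)^[Q] y⌋₊), ?_, rfl⟩)) ⟨?_, ?_⟩
    · rw [Finset.mem_product]
      refine ⟨hG y hy, Finset.mem_range.2 (Nat.lt_succ_of_le (Nat.floor_mono ?_))⟩
      nlinarith [hmy.2]
    · rw [lt_div_iff₀ (by positivity), pow_succ]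
      unfold SameBranch at hb
      nlinarith
    · rw [div_le_iff₀ (by positivity), pow_succ]
      nlinarith

/-- At a scale `θ` below the distances between discontinuities, the iterates `f_β^q`, `q ≤ Q`, have
at most two branches. -/
theorem exists_two_branches {β : ℝ} (hβ : 1 < β) (Q : ℕ) :
    ∃ θ > 0, ∀ q ≤ Q, ∀ J ⊆ Icc (0 : ℝ) 1, (∀ x ∈ J, ∀ y ∈ J, y - x ≤ θ) →
      ∃ d, ∀ x ∈ J, ∀ y ∈ J, (x < d ↔ y < d) → SameBranch β q x y := by
  classical
  obtain ⟨D, hD⟩ := exists_discontinuities hβ Q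
  obtain ⟨θ, hθ0, hθ⟩ : ∃ θ > 0, ∀ d ∈ D, ∀ d' ∈ D, d < d' → θ ≤ d' - d := by
    rcases ((D ×ˢ D).filter fun a => a.1 < a.2).eq_empty_or_nonempty with h | h
    · refine ⟨1, one_pos, fun d hd d' hd' hlt => ?_⟩
      have h1 : (d, d') ∈ (D ×ˢ D).filter fun a => a.1 < a.2 := by simp [hd, hd', hlt]
      simp [h] at h1
    · obtain ⟨a, ha, hmin⟩ := Finset.exists_min_image _ (fun a : ℝ × ℝ => a.2 - a.1) h
      refine ⟨a.2 - a.1, sub_pos.2 (Finset.mem_filter.1 ha).2, fun d hd d' hd' hlt => ?_⟩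
      exact hmin (d, d') (by simp [hd, hd', hlt])
  refine ⟨θ / 2, by positivity, fun q hq J hJ hJθ => ?_⟩
  by_cases hex : ∃ d ∈ D, ∃ x ∈ J, ∃ y ∈ J, x < d ∧ d ≤ y
  · obtain ⟨d, hdD, x₀, hx₀, y₀, hy₀, hxd, hdy⟩ := hex
    have key : ∀ x ∈ J, ∀ y ∈ J, x ≤ y → (x < d ↔ y < d) → SameBranch β q x y := by
      intro x hx y hy hxy hiff
      refine hD q hq x (hJ hx) y (hJ hy) hxy fun d' hd' ⟨h1, h2⟩ => ?_
      have h3 := hJθ x hx y₀ hy₀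
      have h4 := hJθ x₀ hx₀ y hy
      rcases lt_trichotomy d d' with h | h | h
      · linarith [hθ d hdD d' hd' h]
      · subst h
        exact absurd (hiff.1 h1) (not_lt.2 h2)
      · linarith [hθ d' hd' d hdD h]
    refine ⟨d, fun x hx y hy hiff => ?_⟩
    rcases le_total x y with h | h
    · exact key x hx y hy h hiff
    · exact (key y hy x hx h hiff.symm).symm
  · push Not at hex
    have key : ∀ x ∈ J, ∀ y ∈ J, x ≤ y → SameBranch β q x y := by
      intro x hx y hy hxy
      refine hD q hq x (hJ hx) y (hJ hy) hxy fun d' hd' ⟨h1, h2⟩ => ?_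
      exact absurd h2 (not_le.2 (hex d' hd' x hx y hy h1))
    refine ⟨0, fun x hx y hy _ => ?_⟩
    rcases le_total x y with h | h
    · exact key x hx y hy h
    · exact (key y hy x hx h).symm

/-! ### Forbidden sets and the dyadic scale at which they act -/

/-- The times `n` assigned to the dyadic level `m`: those for which `f_β^n` expands an interval of
level `m` to a length between `θ / 2` and `θ`. -/
def times (β θ : ℝ) (m : ℕ) : Set ℕ := {n | 2 ^ m * θ / 2 < β ^ n ∧ β ^ n ≤ 2 ^ m * θ}

theorem exists_mem_times {β θ : ℝ} (hβ : 1 < β) (hθ0 : 0 < θ) (hθ1 : θ ≤ 1) (n : ℕ) :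
    ∃ m, n ∈ times β θ m := by
  classical
  have hex : ∃ m : ℕ, β ^ n ≤ 2 ^ m * θ := by
    obtain ⟨m, hm⟩ := pow_unbounded_of_one_lt (β ^ n / θ) (one_lt_two (α := ℝ))
    exact ⟨m, by rw [div_lt_iff₀ hθ0] at hm; exact hm.le⟩
  refine ⟨Nat.find hex, ?_, Nat.find_spec hex⟩
  rcases Nat.eq_zero_or_pos (Nat.find hex) with h | h
  · rw [h]
    have := one_le_pow₀ (n := n) hβ.le
    linarith
  · obtain ⟨m, hm⟩ := Nat.exists_eq_add_of_le' h
    have h1 := Nat.find_min hex (m := m) (by omega)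
    rw [hm, pow_succ]
    linarith

theorem times_subset_Ico {β θ : ℝ} (hβ : 1 < β) {τ : ℕ} (hτ : 2 ≤ β ^ τ) (m : ℕ) :
    ∃ n₀, times β θ m ⊆ Ico n₀ (n₀ + τ) := by
  classical
  by_cases hex : ∃ n, n ∈ times β θ m
  · refine ⟨Nat.find hex, fun n hn => ⟨Nat.find_min' hex hn, ?_⟩⟩
    by_contra h
    push Not at h
    have h1 := (Nat.find_spec hex).1
    have h2 : β ^ (Nat.find hex + τ) ≤ β ^ n := pow_le_pow_right₀ hβ.le h
    rw [pow_add] at h2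
    have h3 : 0 < β ^ Nat.find hex := by positivity
    nlinarith [hn.2]
  · exact ⟨0, fun n hn => absurd ⟨n, hn⟩ hex⟩

/-- The points whose orbit is in `V` at some time assigned to the level `m`. -/
def forbidden (β θ : ℝ) (V : Set ℝ) (m : ℕ) : Set ℝ :=
  {y | ∃ n ∈ times β θ m, (betaMap β)^[n] y ∈ V}

/-- An interval on which the orbits have so far avoided `0` lies on one branch: at the first
discontinuity of an iterate, some orbit would pass through `0`. -/
theorem sameBranch_of_disjoint_forbidden {β θ : ℝ} (hβ : 1 < β) (hθ0 : 0 < θ) (hθ1 : θ ≤ 1)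
    {V : Set ℝ} (hV : (0 : ℝ) ∈ V) {k Q m : ℕ} (hQ : 2 ^ k ≤ β ^ Q) {a b : ℝ}
    (hI : ∀ m', m' + k ≤ m → Disjoint (Icc a b) (forbidden β θ V m')) {n : ℕ}
    (hn : n ∈ times β θ m) (p : ℕ) (hp : p ≤ n - Q) {x y : ℝ} (hx : x ∈ Icc a b)
    (hy : y ∈ Icc a b) (hxy : x ≤ y) : SameBranch β p x y := by
  have hβ0 : 0 < β := by linarith
  induction p generalizing x y with
  | zero => simp [SameBranch]
  | succ p ih =>
    have hb := ih (by omega) hx hy hxy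
    refine hb.succ ?_
    by_contra hne
    have hle : (betaMap β)^[p] x ≤ (betaMap β)^[p] y := by
      have : 0 ≤ β ^ p * (y - x) := mul_nonneg (by positivity) (by linarith)
      unfold SameBranch at hb
      linarith
    have hlt : ⌊β * (betaMap β)^[p] x⌋ < ⌊β * (betaMap β)^[p] y⌋ :=
      lt_of_le_of_ne (Int.floor_mono (by gcongr)) hne
    set j := ⌊β * (betaMap β)^[p] y⌋ with hj
    have h1 : β * (betaMap β)^[p] x < j := Int.floor_lt.1 hlt
    have h2 : (j : ℝ) ≤ β * (betaMap β)^[p] y := Int.floor_le _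
    unfold SameBranch at hb
    have hp0 : 0 < β ^ p := by positivity
    obtain ⟨z, hz⟩ : ∃ z, z = x + (j / β - (betaMap β)^[p] x) / β ^ p := ⟨_, rfl⟩
    have hzx : β ^ p * (z - x) = j / β - (betaMap β)^[p] x := by
      rw [hz]
      field_simp
      ring
    have h3 : (betaMap β)^[p] x < j / β := by
      rw [lt_div_iff₀ hβ0]
      linarith
    have h4 : j / β ≤ (betaMap β)^[p] y := by
      rw [div_le_iff₀ hβ0]
      linarith
    have hxz : x ≤ z := by
      by_contra h
      nlinarith
    have hzy : z ≤ y := by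
      by_contra h
      nlinarith
    have hzI : z ∈ Icc a b := ⟨hx.1.trans hxz, hzy.trans hy.2⟩
    have hbz := ih (by omega) hx hzI hxz
    unfold SameBranch at hbz
    have h5 : (betaMap β)^[p + 1] z = 0 := by
      have h6 : (betaMap β)^[p] z = j / β := by linarith
      rw [Function.iterate_succ_apply', h6, betaMap, mul_div_cancel₀ _ hβ0.ne', Int.fract_intCast]
    obtain ⟨m', hm'⟩ := exists_mem_times hβ hθ0 hθ1 (p + 1)
    have h7 : m' + k ≤ m := by
      have h8 : β ^ (p + 1) * β ^ Q ≤ β ^ n := by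
        rw [← pow_add]
        exact pow_le_pow_right₀ hβ.le (by omega)
      have h9 : β ^ (p + 1) * 2 ^ k ≤ β ^ (p + 1) * β ^ Q := by gcongr
      have h10 : 2 ^ m' * θ / 2 * 2 ^ k < β ^ (p + 1) * 2 ^ k := by
        have := hm'.1
        gcongr
      have h11 : (2 : ℝ) ^ (m' + k) < 2 ^ (m + 1) := by
        rw [pow_add, pow_succ]
        have := hn.2
        by_contra h
        push Not at h
        nlinarith
      have h12 := (pow_lt_pow_iff_right₀ (one_lt_two (α := ℝ))).1 h11
      omega
    exact (hI m' h7).le_bot ⟨hzI, p + 1, hm', h5 ▸ hV⟩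

/-- On an interval of level `m` on which the orbits have so far avoided `0`, the points that visit
`V` at a time assigned to the level `m` are covered by at most two rescaled copies, for each such
time, of a cover of `V`. -/
theorem isCoveredBy_forbidden {β θ : ℝ} (hβ : 1 < β) (hθ0 : 0 < θ) (hθ1 : θ ≤ 1)
    {V₀ : Set ℝ} (hV₀ : (0 : ℝ) ∈ V₀) {k Q m τ : ℕ} (hQ : 2 ^ k ≤ β ^ Q) (hτ : 2 ≤ β ^ τ)
    (hgap : ∀ q ≤ Q, ∀ J ⊆ Icc (0 : ℝ) 1, (∀ x ∈ J, ∀ y ∈ J, y - x ≤ θ) →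
      ∃ d, ∀ x ∈ J, ∀ y ∈ J, (x < d ↔ y < d) → SameBranch β q x y)
    {a b : ℝ} (hab : Icc a b ⊆ Icc 0 1) (hlen : b - a ≤ 1 / 2 ^ m)
    (hI : ∀ m', m' + k ≤ m → Disjoint (Icc a b) (forbidden β θ V₀ m'))
    {V : Set ℝ} {M h : ℝ} (hh : 0 ≤ h) (hV : IsCoveredBy V M h) :
    IsCoveredBy (Icc a b ∩ forbidden β θ V m) (τ * (2 * M)) (2 * h / (2 ^ m * θ)) := by
  classical
  have hβ0 : 0 < β := by linarith
  have hM : 0 ≤ M := by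
    obtain ⟨P, hP, -⟩ := hV
    exact (Nat.cast_nonneg _).trans hP
  have hone : ∀ n ∈ times β θ m, IsCoveredBy {y | y ∈ Icc a b ∧ (betaMap β)^[n] y ∈ V} (2 * M)
      (h / β ^ n) := by
    intro n hn
    have hn0 : 0 < β ^ n := by positivity
    have hbr : ∀ x ∈ Icc a b, ∀ y ∈ Icc a b, SameBranch β (n - Q) x y := by
      intro x hx y hy
      rcases le_total x y with hxy | hxy
      · exact sameBranch_of_disjoint_forbidden hβ hθ0 hθ1 hV₀ hQ hI hn _ le_rfl hx hy hxy
      · exact (sameBranch_of_disjoint_forbidden hβ hθ0 hθ1 hV₀ hQ hI hn _ le_rfl hy hx hxy).symm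
    obtain ⟨d, hd⟩ := hgap (n - (n - Q)) (by omega) ((betaMap β)^[n - Q] '' Icc a b) (by
      rintro _ ⟨x, hx, rfl⟩
      exact iterate_betaMap_mem_Icc β (hab hx) _) (by
      rintro _ ⟨x, hx, rfl⟩ _ ⟨y, hy, rfl⟩
      rw [hbr x hx y hy]
      have h1 : β ^ (n - Q) ≤ 2 ^ m * θ :=
        (pow_le_pow_right₀ hβ.le (Nat.sub_le n Q)).trans hn.2
      have h2 : y - x ≤ 1 / 2 ^ m := by linarith [hx.1, hy.2]
      have h3 : 0 < β ^ (n - Q) := by positivity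
      calc β ^ (n - Q) * (y - x) ≤ β ^ (n - Q) * (1 / 2 ^ m) := by gcongr
        _ ≤ 2 ^ m * θ * (1 / 2 ^ m) := by gcongr
        _ = θ := by field_simp)
    have hbn : ∀ x ∈ Icc a b, ∀ y ∈ Icc a b,
        ((betaMap β)^[n - Q] x < d ↔ (betaMap β)^[n - Q] y < d) → SameBranch β n x y := by
      intro x hx y hy hiff
      have h1 := (hbr x hx y hy).comp
        (hd _ (mem_image_of_mem _ hx) _ (mem_image_of_mem _ hy) hiff)
      rwa [Nat.sub_add_cancel (Nat.sub_le n Q)] at h1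
    have hpiece : ∀ I' : Set ℝ, (∀ x ∈ I', ∀ y ∈ I', SameBranch β n x y) →
        IsCoveredBy {y | y ∈ I' ∧ (betaMap β)^[n] y ∈ V} M (h / β ^ n) := by
      intro I' hI'
      rcases I'.eq_empty_or_nonempty with rfl | ⟨x₀, hx₀⟩
      · exact ⟨∅, by simpa using hM, by simp⟩
      · obtain ⟨P, hP, hc⟩ := hV
        refine ⟨P.image fun p => x₀ + (p - (betaMap β)^[n] x₀) / β ^ n, ?_, ?_⟩
        · refine le_trans ?_ hP
          exact_mod_cast Finset.card_image_le
        · rintro y ⟨hy, hyV⟩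
          obtain ⟨p, hp, hp1, hp2⟩ := hc _ hyV
          refine ⟨_, Finset.mem_image_of_mem _ hp, ?_⟩
          have h1 := hI' x₀ hx₀ y hy
          unfold SameBranch at h1
          have h2 : y = x₀ + ((betaMap β)^[n] y - (betaMap β)^[n] x₀) / β ^ n := by
            rw [h1]
            field_simp
            ring
          constructor
          · rw [h2]
            gcongr
          · rw [h2, add_assoc, ← add_div]
            gcongr
            linarith
    have hu := (hpiece {y | y ∈ Icc a b ∧ (betaMap β)^[n - Q] y < d}
      (fun x hx y hy => hbn x hx.1 y hy.1 (iff_of_true hx.2 hy.2))).union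
      (hpiece {y | y ∈ Icc a b ∧ ¬ (betaMap β)^[n - Q] y < d}
      (fun x hx y hy => hbn x hx.1 y hy.1 (iff_of_false hx.2 hy.2)))
    refine hu.mono ?_ (by linarith) le_rfl
    rintro y ⟨hy, hyV⟩
    by_cases hyd : (betaMap β)^[n - Q] y < d
    · exact Or.inl ⟨⟨hy, hyd⟩, hyV⟩
    · exact Or.inr ⟨⟨hy, hyd⟩, hyV⟩
  obtain ⟨n₀, hn₀⟩ := times_subset_Ico (θ := θ) hβ hτ m
  have hcov := IsCoveredBy.biUnion ((Finset.Ico n₀ (n₀ + τ)).filter fun n => n ∈ times β θ m)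
    (S := fun n => {y | y ∈ Icc a b ∧ (betaMap β)^[n] y ∈ V}) (M := 2 * M)
    (h := 2 * h / (2 ^ m * θ)) (by
      intro n hn
      have hnT := (Finset.mem_filter.1 hn).2
      refine (hone n hnT).mono le_rfl le_rfl ?_
      have hn1 := hnT.1
      rw [div_le_div_iff₀ (by positivity) (by positivity)]
      nlinarith)
  refine hcov.mono ?_ ?_ le_rfl
  · rintro y ⟨hy, n, hn, hyV⟩
    simp only [mem_iUnion]
    exact ⟨n, Finset.mem_filter.2 ⟨Finset.mem_Ico.2 (hn₀ hn), hn⟩, hy, hyV⟩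
  · gcongr
    exact (Finset.card_filter_le _ _).trans_eq (by simp)

theorem IsCoveredBy.thickening {K : Set ℝ} {M δ : ℝ} (H : IsCoveredBy K M δ) :
    IsCoveredBy (Metric.thickening δ K) M (3 * δ) := by
  classical
  obtain ⟨P, hP, hc⟩ := H
  refine ⟨P.image fun p => p - δ, ?_, fun x hx => ?_⟩
  · refine le_trans ?_ hP
    exact_mod_cast Finset.card_image_le
  · obtain ⟨z, hz, hxz⟩ := Metric.mem_thickening_iff.1 hx
    obtain ⟨p, hp, hp1, hp2⟩ := hc z hz
    rw [Real.dist_eq, abs_lt] at hxz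
    exact ⟨p - δ, Finset.mem_image_of_mem _ hp, by linarith, by linarith⟩

theorem exists_div_pow_le (A : ℝ) {a ε : ℝ} (ha : 1 < a) (hε : 0 < ε) :
    ∃ k : ℕ, 1 ≤ k ∧ A / a ^ k ≤ ε := by
  obtain ⟨k, hk⟩ := pow_unbounded_of_one_lt (A / ε) ha
  refine ⟨k + 1, by omega, ?_⟩
  rw [div_lt_iff₀ hε] at hk
  rw [div_le_iff₀ (by positivity)]
  have : a ^ k ≤ a ^ (k + 1) := pow_le_pow_right₀ ha.le (by omega)
  nlinarith

/-- The removal rules of one `β`-map. The rule `false` keeps the orbits away from the two ends of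
`[0, 1]`, so that the next rule has to deal with two branches only; the rule `true` keeps them away
from `K`. The number of intervals that the rule `false` removes is bounded independently of the
scales, while for the rule `true` it grows with an exponent below `s`. -/
theorem exists_rules {β : ℝ} (hβ : 1 < β) {K : Set ℝ} {s₀ s C : ℝ} (hs : 0 < s) (hs₀ : s₀ < s)
    (hC : 0 ≤ C) (hK : ∀ δ, 0 < δ → δ ≤ 1 → IsCoveredBy K (C * δ ^ (-s₀)) δ) {ε : ℝ}
    (hε : 0 < ε) :
    ∃ (k : Bool → ℕ) (R : Bool → ℝ) (B : Bool → ℕ → Set ℝ), (∀ r, 1 ≤ k r) ∧ (∀ r, 0 ≤ R r) ∧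
      (∀ r, R r * (2 : ℝ) ^ s / ((2 : ℝ) ^ s) ^ k r ≤ ε) ∧
      (∀ r m i, i < 2 ^ m → (∀ r' m', m' + k r' ≤ m → Disjoint (dyadic m i) (B r' m')) →
        ∀ F : Finset ℕ, (∀ i' ∈ F, i' / 2 ^ k r = i ∧ (dyadic (m + k r) i' ∩ B r m).Nonempty) →
        (F.card : ℝ) ≤ R r) ∧
      ∀ y ∈ Icc (0 : ℝ) 1, (∀ r m, y ∉ B r m) → y ∈ avoiding β K := by
  obtain ⟨τ, hτ⟩ := pow_unbounded_of_one_lt 2 hβ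
  have hlam1 : (1 : ℝ) < 2 ^ s := Real.one_lt_rpow (by norm_num) hs
  -- The order of choice matters: `k₀` depends only on `β`, `s` and `ε`; then `θ` has to be small
  -- for the number `Q` of steps that corresponds to `k₀` levels; and `k₁` has to be large for `θ`.
  obtain ⟨k₀, hk₀1, hk₀⟩ := exists_div_pow_le (16 * τ * 2 ^ s) hlam1 hε
  obtain ⟨Q, hQ⟩ := pow_unbounded_of_one_lt (2 ^ k₀) hβ
  obtain ⟨θ', hθ'0, hθ'⟩ := exists_two_branches hβ Q
  obtain ⟨θ, hθ0, hθ1, hθθ'⟩ : ∃ θ > 0, θ ≤ 1 ∧ θ ≤ θ' :=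
    ⟨min 1 θ', lt_min one_pos hθ'0, min_le_left _ _, min_le_right _ _⟩
  have hgap : ∀ q ≤ Q, ∀ J ⊆ Icc (0 : ℝ) 1, (∀ x ∈ J, ∀ y ∈ J, y - x ≤ θ) →
      ∃ d, ∀ x ∈ J, ∀ y ∈ J, (x < d ↔ y < d) → SameBranch β q x y := fun q hq J hJ h =>
    hθ' q hq J hJ fun x hx y hy => (h x hx y hy).trans hθθ'
  have hratio : (1 : ℝ) < 2 ^ (s - s₀) := Real.one_lt_rpow (by norm_num) (by linarith)
  obtain ⟨k₁, hk₁1, hk₁⟩ :=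
    exists_div_pow_le (2 * C * τ * (6 / θ + 2) * 2 ^ s) hratio hε
  set δ₀ : ℝ := θ / 2 ^ k₀ with hδ₀
  set δ₁ : ℝ := 1 / 2 ^ k₁ with hδ₁
  have hδ₀0 : 0 < δ₀ := by positivity
  have hδ₁0 : 0 < δ₁ := by positivity
  have hδ₁1 : δ₁ ≤ 1 := div_le_one_of_le₀ (one_le_pow₀ (by norm_num)) (by positivity)
  set V₀ : Set ℝ := Icc 0 (0 + δ₀) ∪ Icc (1 - δ₀) (1 - δ₀ + δ₀) with hV₀
  have h0V₀ : (0 : ℝ) ∈ V₀ := Or.inl ⟨le_rfl, by linarith⟩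
  have hcov₀ : IsCoveredBy V₀ 2 δ₀ :=
    ((isCoveredBy_Icc 0 δ₀).union (isCoveredBy_Icc (1 - δ₀) δ₀)).mono le_rfl (by norm_num) le_rfl
  have hcov₁ : IsCoveredBy (Metric.thickening δ₁ K) (C * δ₁ ^ (-s₀)) (3 * δ₁) :=
    (hK δ₁ hδ₁0 hδ₁1).thickening
  have hcount : ∀ m i, i < 2 ^ m →
      (∀ m', m' + k₀ ≤ m → Disjoint (dyadic m i) (forbidden β θ V₀ m')) →
      ∀ (V : Set ℝ) (M h : ℝ), 0 ≤ h → IsCoveredBy V M h → ∀ (k : ℕ) (F : Finset ℕ),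
      (∀ i' ∈ F, i' / 2 ^ k = i ∧ (dyadic (m + k) i' ∩ forbidden β θ V m).Nonempty) →
      (F.card : ℝ) ≤ τ * (2 * M) * (2 * h * 2 ^ k / θ + 2) := by
    intro m i hi hdisj V M h hh hV k F hF
    have hsub : dyadic m i ⊆ Icc 0 1 := by
      apply Icc_subset_Icc
      · positivity
      · rw [div_le_one (by positivity)]
        exact_mod_cast hi
    have h1 := isCoveredBy_forbidden hβ hθ0 hθ1 h0V₀ hQ.le hτ.le hgap hsub
      (by rw [← sub_div, add_sub_cancel_left]) hdisj hh hV
    have h2 := h1.card_dyadic_le (by positivity) (m + k) F fun i' hi' => by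
      obtain ⟨h3, x, hx, hxV⟩ := hF i' hi'
      refine ⟨x, hx, ?_, hxV⟩
      have := dyadic_add_subset m k i' hx
      rwa [h3] at this
    refine h2.trans_eq ?_
    congr 2
    rw [pow_add]
    field_simp
  refine ⟨fun r => bif r then k₁ else k₀,
    fun r => bif r then 2 * C * τ * (6 / θ + 2) * (2 ^ s₀) ^ k₁ else 16 * τ,
    fun r => bif r then forbidden β θ (Metric.thickening δ₁ K) else forbidden β θ V₀,
    ?_, ?_, ?_, ?_, ?_⟩
  · rintro (_ | _)
    exacts [hk₀1, hk₁1]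
  · rintro (_ | _) <;> simp only [cond_true, cond_false] <;> positivity
  · rintro (_ | _) <;> simp only [cond_true, cond_false]
    · exact hk₀
    · refine le_of_eq_of_le ?_ hk₁
      rw [Real.rpow_sub (by norm_num), div_pow]
      field_simp
  · intro r m i hi hdisj F hF
    have hd := fun m' h => hdisj false m' h
    simp only [cond_false] at hd
    cases r
    · simp only [cond_false] at hF ⊢
      refine (hcount m i hi hd V₀ 2 δ₀ hδ₀0.le hcov₀ k₀ F hF).trans_eq ?_
      rw [hδ₀]
      field_simp
      ring
    · simp only [cond_true] at hF ⊢
      refine (hcount m i hi hd _ _ _ (by positivity) hcov₁ k₁ F hF).trans_eq ?_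
      have h1 : δ₁ ^ (-s₀) = (2 ^ s₀) ^ k₁ := by
        rw [hδ₁, one_div, Real.inv_rpow (by positivity), Real.rpow_neg (by positivity), inv_inv,
          ← Real.rpow_natCast, ← Real.rpow_natCast, ← Real.rpow_mul (by norm_num),
          ← Real.rpow_mul (by norm_num), mul_comm]
      rw [h1, hδ₁]
      field_simp
      ring
  · intro y hy hyB
    have hn : ∀ n, (betaMap β)^[n] y ∉ V₀ ∧ (betaMap β)^[n] y ∉ Metric.thickening δ₁ K := by
      intro n
      obtain ⟨m, hm⟩ := exists_mem_times hβ hθ0 hθ1 n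
      exact ⟨fun h => hyB false m ⟨n, hm, h⟩, fun h => hyB true m ⟨n, hm, h⟩⟩
    refine ⟨⟨hy.1, lt_of_le_of_ne hy.2 ?_⟩, ?_⟩
    · rintro rfl
      exact (hn 0).1 (Or.inr ⟨by simpa using hδ₀0.le, by simp⟩)
    · have hcl : closure {z | ∃ n : ℕ, 1 ≤ n ∧ z = (betaMap β)^[n] y} ⊆
          (Metric.thickening δ₁ K)ᶜ := by
        refine closure_minimal ?_ Metric.isOpen_thickening.isClosed_compl
        rintro z ⟨n, -, rfl⟩
        exact (hn n).2
      rw [← disjoint_iff_inter_eq_empty]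
      exact (subset_compl_iff_disjoint_left.1 hcl).mono_left
        (Metric.self_subset_thickening hδ₁0 K)

/-! ### Intersections for several values of `β` -/

/-- If each `K n` is coverable by `O(δ^(-s₀))` intervals of length `δ` for some `s₀ < 1`, the points
whose `β n`-orbits all stay away from the sets `K n` form a set of dimension `1`. -/
theorem dimH_iInter_avoiding_eq_one {N : ℕ} {β : Fin N → ℝ} (hβ : ∀ n, 1 < β n)
    {K : Fin N → Set ℝ} (hK : ∀ n, ∃ s₀ < (1 : ℝ), ∃ C ≥ (0 : ℝ), ∀ δ, 0 < δ → δ ≤ 1 →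
      IsCoveredBy (K n) (C * δ ^ (-s₀)) δ) :
    dimH (⋂ n, avoiding (β n) (K n)) = 1 := by
  choose s₀ hs₀ C hC hcov using hK
  refine le_antisymm ((dimH_mono (subset_univ _)).trans_eq Real.dimH_univ) ?_
  refine le_of_forall_lt fun c hc => ?_
  lift c to NNReal using hc.ne_top with c'
  have hc1 : c' < 1 := by exact_mod_cast hc
  obtain ⟨s, hsc, hss₀, hs1⟩ : ∃ s : NNReal, c' < s ∧ (∀ n, s₀ n < s) ∧ s < 1 := by
    have hev : ∀ᶠ s : ℝ in nhdsWithin 1 (Iio 1), (c' : ℝ) < s ∧ (∀ n, s₀ n < s) ∧ s < 1 := by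
      refine ((eventually_nhdsWithin_of_eventually_nhds (lt_mem_nhds (by exact_mod_cast hc1))).and
        ((Filter.eventually_all.2 fun n => eventually_nhdsWithin_of_eventually_nhds
          (lt_mem_nhds (hs₀ n))).and self_mem_nhdsWithin))
    obtain ⟨s, h1, h2, h3⟩ := hev.exists
    have hs0 : 0 ≤ s := c'.2.trans h1.le
    lift s to NNReal using hs0
    exact ⟨s, by exact_mod_cast h1, h2, by exact_mod_cast h3⟩
  have hs0 : 0 < s := (zero_le).trans_lt hsc
  refine lt_of_lt_of_le (by exact_mod_cast hsc) (?_ : (s : ENNReal) ≤ _)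
  have hlam2 : (2 : ℝ) ^ (s : ℝ) < 2 := by
    calc (2 : ℝ) ^ (s : ℝ) < 2 ^ (1 : ℝ) :=
          Real.rpow_lt_rpow_of_exponent_lt (by norm_num) (by exact_mod_cast hs1)
      _ = 2 := by simp
  -- There are `2 * N` rules; the additional `1` makes the inequality strict, also for `N = 0`.
  set ε : ℝ := (2 - 2 ^ (s : ℝ)) / (2 * N + 1) with hε
  have hε0 : 0 < ε := div_pos (by linarith) (by positivity)
  choose k R B hk hR hsum hcount hav using fun n =>
    exists_rules (hβ n) (s := s) (by exact_mod_cast hs0) (hss₀ n) (hC n) (hcov n) hε0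
  refine (le_dimH_of_rules (ι := Fin N × Bool) (fun r => k r.1 r.2) (fun r => hk _ _)
    (fun r => R r.1 r.2) (fun r => hR _ _) (fun r => B r.1 r.2) hs0 ?_ ?_).trans (dimH_mono ?_)
  · calc ∑ r : Fin N × Bool, R r.1 r.2 * (2 : ℝ) ^ (s : ℝ) / ((2 : ℝ) ^ (s : ℝ)) ^ k r.1 r.2
        ≤ ∑ r : Fin N × Bool, ε := Finset.sum_le_sum fun r _ => hsum _ _
      _ = 2 * N * ε := by
          rw [Finset.sum_const, nsmul_eq_mul]
          simp [mul_comm]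
      _ < (2 * N + 1) * ε := by linarith
      _ = _ := by rw [hε]; field_simp
  · rintro ⟨n, r⟩ m i hi hd F hF
    exact hcount n r m i hi (fun r' m' h => hd (n, r') m' h) F hF
  · rintro y ⟨hy, hyB⟩
    exact mem_iInter.2 fun n => hav n y hy fun r m => hyB (n, r) m

/-! ### Cylinders of the `β`-expansion -/

/-- The points of `[0, 1)` whose first `n` digits are those of `x`. -/
def cyl (β : ℝ) (n : ℕ) (x : ℝ) : Set ℝ :=
  {y | y ∈ Ico (0 : ℝ) 1 ∧ ∀ i < n, digitNat β y i = digitNat β x i}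

theorem self_mem_cyl {β : ℝ} {n : ℕ} {x : ℝ} (hx : x ∈ Ico (0 : ℝ) 1) : x ∈ cyl β n x :=
  ⟨hx, fun _ _ => rfl⟩

theorem digitNat_iterate (β x : ℝ) (m i : ℕ) :
    digitNat β ((betaMap β)^[m] x) i = digitNat β x (m + i) := by
  unfold digitNat
  rw [← Function.iterate_add_apply, add_comm]

theorem iterate_succ_eq_sub_digitNat {β : ℝ} (hβ : 1 < β) {x : ℝ} (hx : x ∈ Ico (0 : ℝ) 1)
    (n : ℕ) : (betaMap β)^[n + 1] x = β * (betaMap β)^[n] x - digitNat β x n := by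
  have h := iterate_betaMap_mem β hx n
  have h1 := natCast_floor_eq_intCast_floor (R := ℝ)
    (mul_nonneg (by linarith : (0 : ℝ) ≤ β) h.1)
  rw [Function.iterate_succ_apply', digitNat, h1]
  exact (Int.self_sub_floor _).symm

theorem sameBranch_of_mem_cyl {β : ℝ} (hβ : 1 < β) {n : ℕ} {x y : ℝ} (hx : x ∈ Ico (0 : ℝ) 1)
    (hy : y ∈ cyl β n x) : SameBranch β n x y := by
  induction n with
  | zero => simp [SameBranch]
  | succ n ih =>
    have h := ih ⟨hy.1, fun i hi => hy.2 i (by omega)⟩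
    unfold SameBranch at *
    rw [iterate_succ_eq_sub_digitNat hβ hx, iterate_succ_eq_sub_digitNat hβ hy.1,
      hy.2 n (by omega), pow_succ]
    linear_combination β * h

/-- The image of a cylinder of order `n` under `f_β^n` is an interval `[0, c)`; the digit that
follows determines the corresponding interval of order `n + 1`. -/
theorem image_cyl_succ {β : ℝ} (hβ : 1 < β) {n : ℕ} {x c : ℝ} (hx : x ∈ Ico (0 : ℝ) 1)
    (hc : (betaMap β)^[n] '' cyl β n x = Ico 0 c) :
    0 < β * c - digitNat β x n ∧
      (betaMap β)^[n + 1] '' cyl β (n + 1) x = Ico 0 (min 1 (β * c - digitNat β x n)) := by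
  have hβ0 : 0 < β := by linarith
  have hlt : ∀ y ∈ cyl β n x, (betaMap β)^[n] y < c := fun y hy =>
    (hc ▸ mem_image_of_mem _ hy : _ ∈ Ico 0 c).2
  have hsucc : ∀ y ∈ cyl β (n + 1) x, (betaMap β)^[n + 1] y < β * c - digitNat β x n := by
    intro y hy
    have h1 := hlt y ⟨hy.1, fun i hi => hy.2 i (by omega)⟩
    rw [iterate_succ_eq_sub_digitNat hβ hy.1, hy.2 n (by omega)]
    nlinarith
  refine ⟨lt_of_le_of_lt (iterate_betaMap_mem β hx (n + 1)).1 (hsucc x (self_mem_cyl hx)), ?_⟩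
  ext z
  constructor
  · rintro ⟨y, hy, rfl⟩
    have h2 := iterate_betaMap_mem β hy.1 (n + 1)
    exact ⟨h2.1, lt_min h2.2 (hsucc y hy)⟩
  · rintro ⟨hz0, hz1⟩
    rw [lt_min_iff] at hz1
    have hu : (z + digitNat β x n) / β ∈ Ico 0 c :=
      ⟨by positivity, by rw [div_lt_iff₀ hβ0]; linarith⟩
    rw [← hc] at hu
    obtain ⟨y, hy, hyu⟩ := hu
    have hyd : digitNat β y n = digitNat β x n := by
      conv_lhs => rw [digitNat, hyu, mul_div_cancel₀ _ hβ0.ne']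
      rw [Nat.floor_add_natCast hz0, Nat.floor_eq_zero.2 hz1.1, zero_add]
    refine ⟨y, ⟨hy.1, fun i hi => ?_⟩, ?_⟩
    · rcases Nat.lt_succ_iff_lt_or_eq.1 hi with h | rfl
      · exact hy.2 i h
      · exact hyd
    · rw [iterate_succ_eq_sub_digitNat hβ hy.1, hyd, hyu, mul_div_cancel₀ _ hβ0.ne',
        add_sub_cancel_right]

theorem exists_image_cyl {β : ℝ} (hβ : 1 < β) (n : ℕ) {x : ℝ} (hx : x ∈ Ico (0 : ℝ) 1) :
    ∃ c, 0 < c ∧ c ≤ 1 ∧ (betaMap β)^[n] '' cyl β n x = Ico 0 c := by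
  induction n with
  | zero =>
    refine ⟨1, one_pos, le_rfl, ?_⟩
    ext z
    simp [cyl]
  | succ n ih =>
    obtain ⟨c, -, -, hc⟩ := ih
    obtain ⟨h1, h2⟩ := image_cyl_succ hβ hx hc
    exact ⟨_, lt_min one_pos h1, min_le_left _ _, h2⟩

theorem cyl_eq_Ico {β : ℝ} (hβ : 1 < β) {n : ℕ} {x c : ℝ} (hx : x ∈ Ico (0 : ℝ) 1)
    (hc : (betaMap β)^[n] '' cyl β n x = Ico 0 c) :
    cyl β n x =
      Ico (x - (betaMap β)^[n] x / β ^ n) (x - (betaMap β)^[n] x / β ^ n + c / β ^ n) := by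
  have hn : 0 < β ^ n := by positivity
  ext y
  have key : y ∈ Ico (x - (betaMap β)^[n] x / β ^ n)
      (x - (betaMap β)^[n] x / β ^ n + c / β ^ n) ↔
      (betaMap β)^[n] x + β ^ n * (y - x) ∈ Ico 0 c := by
    have h1 : (betaMap β)^[n] x = β ^ n * ((betaMap β)^[n] x / β ^ n) := by field_simp
    have h2 : c = β ^ n * (c / β ^ n) := by field_simp
    generalize (betaMap β)^[n] x / β ^ n = u at *
    generalize c / β ^ n = v at *
    rw [h1, h2, ← mul_add]
    constructor
    · rintro ⟨h3, h4⟩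
      constructor
      · exact mul_nonneg hn.le (by linarith)
      · exact mul_lt_mul_of_pos_left (by linarith) hn
    · rintro ⟨h3, h4⟩
      have h5 := nonneg_of_mul_nonneg_right h3 hn
      have h6 := lt_of_mul_lt_mul_left h4 hn.le
      constructor <;> linarith
  rw [key, ← hc]
  constructor
  · intro hy
    have h := sameBranch_of_mem_cyl hβ hx hy
    unfold SameBranch at h
    rw [← h, add_sub_cancel]
    exact mem_image_of_mem _ hy
  · rintro ⟨y', hy', h'⟩
    have h := sameBranch_of_mem_cyl hβ hx hy'
    unfold SameBranch at h
    have h1 : y' = y := by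
      have : β ^ n * (y' - x) = β ^ n * (y - x) := by linarith
      have := mul_left_cancel₀ hn.ne' this
      linarith
    rwa [← h1]

open MeasureTheory Filter Topology

theorem measurable_betaMap (β : ℝ) : Measurable (betaMap β) :=
  measurable_fract.comp (measurable_const_mul β)

theorem measurableSet_cyl {β : ℝ} (hβ : 1 < β) (n : ℕ) {x : ℝ} (hx : x ∈ Ico (0 : ℝ) 1) :
    MeasurableSet (cyl β n x) := by
  obtain ⟨c, -, -, hc⟩ := exists_image_cyl hβ n hx
  rw [cyl_eq_Ico hβ hx hc]
  exact measurableSet_Ico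

theorem volume_cyl {β : ℝ} (hβ : 1 < β) {n : ℕ} {x c : ℝ} (hx : x ∈ Ico (0 : ℝ) 1)
    (hc : (betaMap β)^[n] '' cyl β n x = Ico 0 c) :
    volume (cyl β n x) = ENNReal.ofReal (c / β ^ n) := by
  rw [cyl_eq_Ico hβ hx hc, Real.volume_Ico, add_sub_cancel_left]

/-! ### Points whose orbit misses a cylinder -/

/-- The points of `[0, 1)` whose orbit never enters `H`. -/
def missing (β : ℝ) (H : Set ℝ) : Set ℝ := {x | x ∈ Ico (0 : ℝ) 1 ∧ ∀ m, (betaMap β)^[m] x ∉ H}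

/-- The points of `[0, 1)` whose orbit does not enter `H` up to time `n - L`. If `H` is a cylinder
of order `L`, this condition depends only on the first `n` digits. -/
def missingUpTo (β : ℝ) (H : Set ℝ) (L n : ℕ) : Set ℝ :=
  {x | x ∈ Ico (0 : ℝ) 1 ∧ ∀ m, m + L ≤ n → (betaMap β)^[m] x ∉ H}

theorem missingUpTo_anti (β : ℝ) (H : Set ℝ) (L : ℕ) : Antitone (missingUpTo β H L) :=
  fun _ _ h _ hx => ⟨hx.1, fun m hm => hx.2 m (hm.trans h)⟩

theorem iInter_missingUpTo (β : ℝ) (H : Set ℝ) (L : ℕ) :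
    ⋂ n, missingUpTo β H L n = missing β H := by
  ext x
  rw [mem_iInter]
  exact ⟨fun h => ⟨(h 0).1, fun m => (h (m + L)).2 m le_rfl⟩, fun h n => ⟨h.1, fun m _ => h.2 m⟩⟩

theorem missing_subset_missingUpTo (β : ℝ) (H : Set ℝ) (L n : ℕ) :
    missing β H ⊆ missingUpTo β H L n := fun _ hx => ⟨hx.1, fun m _ => hx.2 m⟩

theorem measurableSet_missingUpTo (β : ℝ) {H : Set ℝ} (hH : MeasurableSet H) (L n : ℕ) :
    MeasurableSet (missingUpTo β H L n) := by
  have : missingUpTo β H L n =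
      Ico 0 1 ∩ ⋂ m, ⋂ (_ : m + L ≤ n), ((betaMap β)^[m] ⁻¹' H)ᶜ := by
    ext x
    simp [missingUpTo]
  rw [this]
  exact measurableSet_Ico.inter (MeasurableSet.iInter fun m => MeasurableSet.iInter fun _ =>
    ((measurable_betaMap β).iterate m hH).compl)

theorem missingUpTo_of_mem_cyl {β : ℝ} {x₀ : ℝ} {L n : ℕ} {x y : ℝ}
    (hx : x ∈ missingUpTo β (cyl β L x₀) L n) (hy : y ∈ cyl β n x) :
    y ∈ missingUpTo β (cyl β L x₀) L n := by
  refine ⟨hy.1, fun m hm hmem => hx.2 m hm ⟨iterate_betaMap_mem β hx.1 m, fun i hi => ?_⟩⟩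
  rw [← hmem.2 i hi, digitNat_iterate, digitNat_iterate, hy.2 _ (by omega)]

theorem iterate_div_pow {β : ℝ} (hβ : 1 < β) {y : ℝ} (hy : y ∈ Ico (0 : ℝ) 1) (k : ℕ) :
    (betaMap β)^[k] (y / β ^ k) = y := by
  have hβ0 : 0 < β := by linarith
  induction k with
  | zero => simp
  | succ k ih =>
    rw [Function.iterate_succ_apply]
    have h1 : β * (y / β ^ (k + 1)) = y / β ^ k := by
      rw [pow_succ]
      field_simp
    have h2 : y / β ^ k < 1 := by
      rw [div_lt_one (by positivity)]
      exact hy.2.trans_le (one_le_pow₀ hβ.le)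
    rw [betaMap, h1, Int.fract_eq_self.2 ⟨div_nonneg hy.1 (by positivity), h2⟩, ih]

/-- Every interval `[0, c)` contains, in a fixed proportion, a copy of the interval `H`, namely
`β ^ (-k) * H` for a suitable `k`, whose points enter `H` at time `k`. -/
theorem volume_missing_inter_Ico_le {β : ℝ} (hβ : 1 < β) {p a : ℝ} (ha : 0 ≤ a)
    (hH : Ico p (p + a) ⊆ Ico 0 1) {c : ℝ} (hc0 : 0 < c) (hc1 : c ≤ 1) :
    volume (missing β (Ico p (p + a)) ∩ Ico 0 c) ≤ ENNReal.ofReal ((1 - a / β) * c) := by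
  have hβ0 : 0 < β := by linarith
  rcases ha.eq_or_lt with rfl | ha0
  · refine (measure_mono inter_subset_right).trans ?_
    simp
  have hp0 : 0 ≤ p := (hH ⟨le_rfl, by linarith⟩).1
  have hp1 : p + a ≤ 1 := by
    by_contra h
    push Not at h
    have h1 := (hH (a := max p 1) ⟨le_max_left _ _, max_lt (by linarith) h⟩).2
    exact absurd h1 (not_lt.2 (le_max_right _ _))
  obtain ⟨n, hn1, hn2⟩ := exists_nat_pow_near_of_lt_one hc0 hc1 (inv_pos.2 hβ0)
    (inv_lt_one_of_one_lt₀ hβ)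
  set k := n + 1 with hk
  have hk0 : 0 < β ^ k := by positivity
  rw [inv_pow] at hn1
  have hsubset : missing β (Ico p (p + a)) ∩ Ico 0 c ⊆
      Ico 0 c \ Ico (p / β ^ k) ((p + a) / β ^ k) := by
    rintro x ⟨hx, hxc⟩
    refine ⟨hxc, fun hx' => ?_⟩
    rw [mem_Ico, div_le_iff₀ hk0, lt_div_iff₀ hk0] at hx'
    have h1 := iterate_div_pow hβ (hH hx') k
    rw [mul_div_cancel_right₀ _ hk0.ne'] at h1
    exact hx.2 k (h1 ▸ hx')
  refine (measure_mono hsubset).trans ?_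
  have hinc : Ico (p / β ^ k) ((p + a) / β ^ k) ⊆ Ico 0 c := by
    apply Ico_subset_Ico (by positivity)
    calc (p + a) / β ^ k ≤ 1 / β ^ k := by gcongr
      _ = (β ^ k)⁻¹ := one_div _
      _ ≤ c := hn1.le
  rw [measure_sdiff hinc measurableSet_Ico.nullMeasurableSet (by simp), Real.volume_Ico,
    Real.volume_Ico, ← ENNReal.ofReal_sub _ (by rw [← sub_div, add_sub_cancel_left]; positivity)]
  apply ENNReal.ofReal_le_ofReal
  have h2 : a * (c / β) ≤ a * (β ^ k)⁻¹ := by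
    gcongr
    rw [div_le_iff₀ hβ0, hk, pow_succ, mul_inv, mul_assoc, inv_mul_cancel₀ hβ0.ne', mul_one,
      ← inv_pow]
    exact hn2
  rw [← sub_div, add_sub_cancel_left, div_eq_mul_inv a (β ^ k)]
  have h3 : (1 - a / β) * c = c - a * (c / β) := by ring
  rw [h3]
  linarith

theorem volume_missing_inter_cyl_le {β : ℝ} (hβ : 1 < β) {p a : ℝ} (ha : 0 ≤ a)
    (hH : Ico p (p + a) ⊆ Ico 0 1) (n : ℕ) {x : ℝ} (hx : x ∈ Ico (0 : ℝ) 1) :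
    volume (missing β (Ico p (p + a)) ∩ cyl β n x) ≤
      ENNReal.ofReal (1 - a / β) * volume (cyl β n x) := by
  obtain ⟨c, hc0, hc1, hc⟩ := exists_image_cyl hβ n hx
  have hn : 0 < β ^ n := by positivity
  have hsub : missing β (Ico p (p + a)) ∩ cyl β n x ⊆ (fun y => β ^ n * y) ⁻¹'
      ((fun z => z + ((betaMap β)^[n] x - β ^ n * x)) ⁻¹'
        (missing β (Ico p (p + a)) ∩ Ico 0 c)) := by
    rintro y ⟨hy, hyc⟩
    have h1 := sameBranch_of_mem_cyl hβ hx hyc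
    unfold SameBranch at h1
    have h2 : β ^ n * y + ((betaMap β)^[n] x - β ^ n * x) = (betaMap β)^[n] y := by linarith
    simp only [mem_preimage]
    rw [h2]
    refine ⟨⟨iterate_betaMap_mem β hy.1 n, fun m => ?_⟩, hc ▸ mem_image_of_mem _ hyc⟩
    rw [← Function.iterate_add_apply]
    exact hy.2 _
  refine (measure_mono hsub).trans ?_
  rw [Real.volume_preimage_mul_left hn.ne', measure_preimage_add_right, volume_cyl hβ hx hc,
    abs_of_pos (inv_pos.2 hn), div_eq_inv_mul c, ENNReal.ofReal_mul (inv_pos.2 hn).le,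
    mul_left_comm]
  gcongr
  rw [← ENNReal.ofReal_mul' hc0.le]
  exact volume_missing_inter_Ico_le hβ ha hH hc0 hc1

/-! ### Counting words -/

/-- The word formed by the first `n` digits of `x`. -/
def word (β : ℝ) (n : ℕ) (x : ℝ) : Fin n → ℕ := fun i => digitNat β x i

theorem mem_cyl_iff {β : ℝ} {n : ℕ} {x y : ℝ} (hy : y ∈ Ico (0 : ℝ) 1) :
    y ∈ cyl β n x ↔ word β n y = word β n x :=
  ⟨fun h => funext fun i => h.2 i i.2, fun h => ⟨hy, fun i hi => congrFun h ⟨i, hi⟩⟩⟩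

/-- The words of length `n` of the points of `[0, 1)` whose orbit misses `H` up to time `n - L`. -/
def missingWords (β : ℝ) (H : Set ℝ) (L n : ℕ) : Set (Fin n → ℕ) :=
  word β n '' missingUpTo β H L n

theorem finite_missingWords (β : ℝ) (H : Set ℝ) (L n : ℕ) : (missingWords β H L n).Finite := by
  refine (Set.Finite.pi' fun _ : Fin n => Set.finite_lt_nat (maxDigit β + 1)).subset ?_
  rintro _ ⟨x, hx, rfl⟩ i
  exact digitNat_lt β hx.1 i

theorem exists_representatives (β : ℝ) (H : Set ℝ) (L n : ℕ) :
    ∃ T : Finset ℝ, (∀ t ∈ T, t ∈ missingUpTo β H L n) ∧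
      (∀ t ∈ T, ∀ t' ∈ T, word β n t = word β n t' → t = t') ∧
      (∀ x ∈ missingUpTo β H L n, ∃ t ∈ T, word β n x = word β n t) ∧
      T.card = (missingWords β H L n).ncard := by
  classical
  have hfin := finite_missingWords β H L n
  have hex : ∀ v : Fin n → ℕ, ∃ x, v ∈ missingWords β H L n →
      x ∈ missingUpTo β H L n ∧ word β n x = v := by
    intro v
    by_cases hv : v ∈ missingWords β H L n
    · obtain ⟨x, hx⟩ := hv
      exact ⟨x, fun _ => hx⟩
    · exact ⟨0, fun h => absurd h hv⟩
  choose rep hrep using hex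
  refine ⟨hfin.toFinset.image rep, ?_, ?_, ?_, ?_⟩
  · intro t ht
    obtain ⟨v, hv, rfl⟩ := Finset.mem_image.1 ht
    exact (hrep v (hfin.mem_toFinset.1 hv)).1
  · intro t ht t' ht' h
    obtain ⟨v, hv, rfl⟩ := Finset.mem_image.1 ht
    obtain ⟨v', hv', rfl⟩ := Finset.mem_image.1 ht'
    rw [(hrep v (hfin.mem_toFinset.1 hv)).2, (hrep v' (hfin.mem_toFinset.1 hv')).2] at h
    rw [h]
  · intro x hx
    have hv : word β n x ∈ missingWords β H L n := mem_image_of_mem _ hx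
    exact ⟨_, Finset.mem_image_of_mem _ (hfin.mem_toFinset.2 hv), (hrep _ hv).2.symm⟩
  · rw [Set.ncard_eq_toFinset_card _ hfin]
    refine Finset.card_image_of_injOn fun v hv v' hv' h => ?_
    rw [Finset.mem_coe, hfin.mem_toFinset] at hv hv'
    rw [← (hrep v hv).2, ← (hrep v' hv').2, h]

/-- Disjoint cylinders that meet `missingUpTo` fill at most its measure. -/
theorem sum_volume_cyl_le {β : ℝ} (hβ : 1 < β) {x₀ : ℝ} {L n : ℕ} {T : Finset ℝ}
    (hT : ∀ t ∈ T, t ∈ missingUpTo β (cyl β L x₀) L n)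
    (hinj : ∀ t ∈ T, ∀ t' ∈ T, word β n t = word β n t' → t = t') :
    ∑ t ∈ T, volume (cyl β n t) ≤ volume (missingUpTo β (cyl β L x₀) L n) := by
  rw [← measure_biUnion_finset]
  · refine measure_mono fun y hy => ?_
    simp only [mem_iUnion] at hy
    obtain ⟨t, ht, hy⟩ := hy
    exact missingUpTo_of_mem_cyl (hT t ht) hy
  · intro t ht t' ht' hne
    refine Set.disjoint_left.2 fun y hy hy' => hne (hinj t ht t' ht' ?_)
    rw [← (mem_cyl_iff hy.1).1 hy, (mem_cyl_iff hy.1).1 hy']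
  · exact fun t ht => measurableSet_cyl hβ n (hT t ht).1

/-- Almost every orbit enters a given cylinder, and so the measure of the set of points that miss
it up to time `n` tends to zero. -/
theorem tendsto_volume_missingUpTo {β : ℝ} (hβ : 1 < β) {x₀ : ℝ} (hx₀ : x₀ ∈ Ico (0 : ℝ) 1)
    (L : ℕ) : Tendsto (fun n => volume (missingUpTo β (cyl β L x₀) L n)) atTop (𝓝 0) := by
  classical
  have hβ0 : 0 < β := by linarith
  have hmeas := measurableSet_cyl hβ L hx₀
  have hfin : ∀ n, volume (missingUpTo β (cyl β L x₀) L n) ≠ ⊤ := fun n =>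
    ne_top_of_le_ne_top (by simp) (measure_mono fun x hx => hx.1 : _ ≤ volume (Ico (0 : ℝ) 1))
  have hlim := tendsto_measure_iInter_atTop (μ := volume)
    (fun n => (measurableSet_missingUpTo β hmeas L n).nullMeasurableSet)
    (missingUpTo_anti β (cyl β L x₀) L) ⟨0, hfin 0⟩
  rw [iInter_missingUpTo] at hlim
  suffices h0 : volume (missing β (cyl β L x₀)) = 0 by rwa [h0] at hlim
  obtain ⟨c, hc0, hc1, hc⟩ := exists_image_cyl hβ L hx₀
  have hcyl := cyl_eq_Ico hβ hx₀ hc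
  set p := x₀ - (betaMap β)^[L] x₀ / β ^ L
  set a := c / β ^ L with ha
  have ha0 : 0 < a := by positivity
  have hH : Ico p (p + a) ⊆ Ico 0 1 := by
    rw [← hcyl]
    exact fun x hx => hx.1
  set κ := ENNReal.ofReal (1 - a / β) with hκ
  have hκ1 : κ < 1 := by
    rw [hκ, ENNReal.ofReal_lt_one]
    have : 0 < a / β := by positivity
    linarith
  have hle : ∀ n, volume (missing β (cyl β L x₀)) ≤
      κ * volume (missingUpTo β (cyl β L x₀) L n) := by
    intro n
    obtain ⟨T, hT, hinj, hcov, -⟩ := exists_representatives β (cyl β L x₀) L n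
    calc volume (missing β (cyl β L x₀))
        ≤ volume (⋃ t ∈ T, missing β (cyl β L x₀) ∩ cyl β n t) := by
          refine measure_mono fun x hx => ?_
          obtain ⟨t, ht, hxt⟩ := hcov x (missing_subset_missingUpTo β _ L n hx)
          simp only [mem_iUnion]
          exact ⟨t, ht, hx, (mem_cyl_iff hx.1).2 hxt⟩
      _ ≤ ∑ t ∈ T, volume (missing β (cyl β L x₀) ∩ cyl β n t) := measure_biUnion_finset_le _ _
      _ ≤ ∑ t ∈ T, κ * volume (cyl β n t) := by
          refine Finset.sum_le_sum fun t ht => ?_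
          rw [hcyl]
          exact volume_missing_inter_cyl_le hβ ha0.le hH n (hT t ht).1
      _ = κ * ∑ t ∈ T, volume (cyl β n t) := by rw [Finset.mul_sum]
      _ ≤ _ := by
          gcongr
          exact sum_volume_cyl_le hβ hT hinj
  have hlim2 := ENNReal.Tendsto.const_mul hlim (Or.inr (ne_top_of_lt hκ1))
  have hle2 := ge_of_tendsto' hlim2 hle
  by_contra hne
  have htop : volume (missing β (cyl β L x₀)) ≠ ⊤ :=
    ne_top_of_le_ne_top (hfin 0) (measure_mono (missing_subset_missingUpTo β _ L 0))
  have := ENNReal.mul_lt_mul_left hne htop hκ1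
  rw [one_mul] at this
  exact absurd hle2 (not_le.2 this)

/-- A cylinder has at most one subcylinder of the next order that `f_β^(n+1)` does not map
onto `[0, 1)`, and the other ones have measure `β ^ -(n + 1)`. -/
theorem ncard_missingWords_succ_le {β : ℝ} (hβ : 1 < β) (x₀ : ℝ) (L n : ℕ) :
    ((missingWords β (cyl β L x₀) L (n + 1)).ncard : ℝ) ≤
      β ^ (n + 1) * (volume (missingUpTo β (cyl β L x₀) L (n + 1))).toReal +
        (missingWords β (cyl β L x₀) L n).ncard := by
  classical
  have hβ0 : 0 < β := by linarith
  have hn0 : 0 < β ^ (n + 1) := by positivity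
  -- Full cylinders are counted by their measure, the others by their parents.
  obtain ⟨T, hT, hinj, -, hcard⟩ := exists_representatives β (cyl β L x₀) L (n + 1)
  have hfin : volume (missingUpTo β (cyl β L x₀) L (n + 1)) ≠ ⊤ :=
    ne_top_of_le_ne_top (by simp) (measure_mono fun x hx => hx.1 : _ ≤ volume (Ico (0 : ℝ) 1))
  set full : ℝ → Prop := fun t => (betaMap β)^[n + 1] '' cyl β (n + 1) t = Ico 0 1 with hfull
  have h1 : ((T.filter full).card : ℝ) ≤
      β ^ (n + 1) * (volume (missingUpTo β (cyl β L x₀) L (n + 1))).toReal := by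
    have h2 := sum_volume_cyl_le hβ (T := T.filter full)
      (fun t ht => hT t (Finset.mem_filter.1 ht).1)
      (fun t ht t' ht' => hinj t (Finset.mem_filter.1 ht).1 t' (Finset.mem_filter.1 ht').1)
    rw [Finset.sum_congr rfl fun t ht => volume_cyl hβ (hT t (Finset.mem_filter.1 ht).1).1
      (Finset.mem_filter.1 ht).2, Finset.sum_const, nsmul_eq_mul] at h2
    have h3 := ENNReal.toReal_mono hfin h2
    rw [ENNReal.toReal_mul, ENNReal.toReal_natCast, ENNReal.toReal_ofReal (by positivity),
      mul_one_div, div_le_iff₀ hn0] at h3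
    linarith
  have h4 : (T.filter fun t => ¬ full t).card ≤ (missingWords β (cyl β L x₀) L n).ncard := by
    rw [Set.ncard_eq_toFinset_card _ (finite_missingWords β (cyl β L x₀) L n)]
    refine Finset.card_le_card_of_injOn (word β n) ?_ ?_
    · intro t ht
      rw [Finset.mem_coe, Finset.mem_filter] at ht
      rw [Finset.mem_coe, Set.Finite.mem_toFinset]
      exact mem_image_of_mem _ (missingUpTo_anti β _ L (Nat.le_succ n) (hT t ht.1))
    · intro t ht t' ht' hw
      rw [Finset.mem_coe, Finset.mem_filter] at ht ht'
      have ht0 := (hT t ht.1).1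
      have ht0' := (hT t' ht'.1).1
      have hcyl : cyl β n t = cyl β n t' := by
        ext y
        constructor <;> intro hy <;> rw [mem_cyl_iff hy.1] at * <;> rw [hy, hw]
      obtain ⟨c, hc0, hc1, hc⟩ := exists_image_cyl hβ n ht0
      obtain ⟨h5, h6⟩ := image_cyl_succ hβ ht0 hc
      obtain ⟨h5', h6'⟩ := image_cyl_succ hβ ht0' (hcyl ▸ hc)
      have h7 : β * c - digitNat β t n < 1 := by
        by_contra h
        exact ht.2 (h6.trans (by rw [min_eq_left (not_lt.1 h)]))
      have h7' : β * c - digitNat β t' n < 1 := by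
        by_contra h
        exact ht'.2 (h6'.trans (by rw [min_eq_left (not_lt.1 h)]))
      have h8 : (digitNat β t n : ℝ) < digitNat β t' n + 1 := by linarith
      have h9 : (digitNat β t' n : ℝ) < digitNat β t n + 1 := by linarith
      have h10 : digitNat β t n = digitNat β t' n := by
        have h8' : digitNat β t n < digitNat β t' n + 1 := by exact_mod_cast h8
        have h9' : digitNat β t' n < digitNat β t n + 1 := by exact_mod_cast h9
        omega
      refine hinj t ht.1 t' ht'.1 (funext fun i => ?_)
      rcases Nat.lt_succ_iff_lt_or_eq.1 i.2 with h | h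
      · exact congrFun hw ⟨i, h⟩
      · simp only [word, h, h10]
  have h11 := Finset.card_filter_add_card_filter_not (s := T) full
  rw [← hcard, ← h11]
  push_cast
  have h4' : ((T.filter fun t => ¬ full t).card : ℝ) ≤
    (missingWords β (cyl β L x₀) L n).ncard := by exact_mod_cast h4
  linarith

/-- Some word length `q` has fewer than `β ^ q` words that miss a given cylinder. -/
theorem exists_ncard_missingWords_lt {β : ℝ} (hβ : 1 < β) {x₀ : ℝ} (hx₀ : x₀ ∈ Ico (0 : ℝ) 1)
    (L : ℕ) : ∃ q, 1 ≤ q ∧ ((missingWords β (cyl β L x₀) L q).ncard : ℝ) < β ^ q := by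
  have hβ0 : 0 < β := by linarith
  set p : ℕ → ℝ := fun n => (volume (missingUpTo β (cyl β L x₀) L n)).toReal with hp
  -- With `ω n` the number of words divided by `β ^ n`, the recursion for the number of words
  -- becomes `ω (n + 1) ≤ p (n + 1) + ω n / β`, where `p n → 0`.
  set ω : ℕ → ℝ := fun n => (missingWords β (cyl β L x₀) L n).ncard / β ^ n with hω
  have hlim : Tendsto p atTop (𝓝 0) := by
    exact (ENNReal.tendsto_toReal ENNReal.zero_ne_top).comp (tendsto_volume_missingUpTo hβ hx₀ L)
  have hε : 0 < (1 - 1 / β) / 2 := by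
    have : 1 / β < 1 := by rw [div_lt_one hβ0]; exact hβ
    linarith
  obtain ⟨n₀, hn₀⟩ := eventually_atTop.1 (hlim.eventually (gt_mem_nhds hε))
  have hstep : ∀ n, ω (n + 1) ≤ p (n + 1) + ω n / β := by
    intro n
    have h1 := ncard_missingWords_succ_le hβ x₀ L n
    simp only [hω]
    rw [div_le_iff₀ (by positivity)]
    refine h1.trans_eq ?_
    simp only [hp]
    rw [pow_succ]
    field_simp
  have hind : ∀ j, ω (n₀ + j) ≤ ω n₀ / β ^ j + 1 / 2 := by
    intro j
    induction j with
    | zero => simp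
    | succ j ih =>
      have h1 := hstep (n₀ + j)
      have h2 := hn₀ (n₀ + j + 1) (by omega)
      have h3 : ω (n₀ + j) / β ≤ (ω n₀ / β ^ j + 1 / 2) / β := by gcongr
      have h4 : (ω n₀ / β ^ j + 1 / 2) / β = ω n₀ / β ^ (j + 1) + 1 / 2 * (1 / β) := by
        rw [pow_succ]
        field_simp
      rw [← add_assoc]
      linarith
  obtain ⟨j, hj⟩ := pow_unbounded_of_one_lt (2 * ω n₀) hβ
  refine ⟨n₀ + (j + 1), by omega, ?_⟩
  have h5 := hind (j + 1)
  have h6 : ω n₀ / β ^ (j + 1) < 1 / 2 := by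
    rw [div_lt_iff₀ (by positivity)]
    have : β ^ j ≤ β ^ (j + 1) := pow_le_pow_right₀ hβ.le (by omega)
    linarith
  have h7 : ω (n₀ + (j + 1)) < 1 := by linarith
  simp only [hω] at h7
  rwa [div_lt_one (by positivity)] at h7

theorem ncard_missingWords_add_le (β : ℝ) (H : Set ℝ) (L n m : ℕ) :
    (missingWords β H L (n + m)).ncard ≤
      (missingWords β H L n).ncard * (missingWords β H L m).ncard := by
  rw [← Set.ncard_prod]
  refine Set.ncard_le_ncard_of_injOn
    (fun v => (fun i => v (Fin.castAdd m i), fun i => v (Fin.natAdd n i))) ?_ ?_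
    ((finite_missingWords β H L n).prod (finite_missingWords β H L m))
  · rintro _ ⟨x, hx, rfl⟩
    refine ⟨⟨x, missingUpTo_anti β H L (Nat.le_add_right n m) hx, rfl⟩, (betaMap β)^[n] x,
      ⟨iterate_betaMap_mem β hx.1 n, fun k hk => ?_⟩, ?_⟩
    · rw [← Function.iterate_add_apply]
      exact hx.2 _ (by omega)
    · funext i
      exact digitNat_iterate β x n i
  · intro v _ v' _ h
    rw [Prod.mk.injEq] at h
    funext i
    refine Fin.addCases (fun i => congrFun h.1 i) (fun i => congrFun h.2 i) i

theorem ncard_missingWords_mul_le (β : ℝ) (H : Set ℝ) (L q j : ℕ) :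
    (missingWords β H L (q * j)).ncard ≤ (missingWords β H L q).ncard ^ j := by
  induction j with
  | zero =>
    rw [mul_zero, pow_zero]
    exact Set.ncard_le_one_of_subsingleton _
  | succ j ih =>
    rw [mul_add, mul_one, pow_succ]
    exact (ncard_missingWords_add_le β H L _ _).trans (Nat.mul_le_mul_right _ ih)

/-! ### Covers of the projection of a proper subshift -/

theorem exists_digitNat_eq_of_mem_betaShift {β : ℝ} {s : ℕ → Digit β} (hs : s ∈ betaShift β)
    (n : ℕ) : ∃ x ∈ Ico (0 : ℝ) 1, ∀ i < n, digitNat β x i = s i := by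
  obtain ⟨_, ht, x, rfl⟩ := mem_closure_iff.1 hs _ (PiNat.isOpen_cylinder _ s n)
    (PiNat.self_mem_cylinder s n)
  exact ⟨x, x.2, fun i hi => congrArg Fin.val (ht i hi)⟩

theorem proj_mem_Icc {β : ℝ} (hβ : 1 < β) (s : ℕ → Digit β) (n : ℕ) :
    proj β s ∈ Icc (∑ i ∈ Finset.range n, ((s i : ℕ) : ℝ) / β ^ (i + 1))
      (∑ i ∈ Finset.range n, ((s i : ℕ) : ℝ) / β ^ (i + 1) + maxDigit β / (β - 1) / β ^ n) := by
  have hβ0 : 0 < β := by linarith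
  have hgeo := hasSum_geometric_of_lt_one (inv_pos.2 hβ0).le (inv_lt_one_of_one_lt₀ hβ)
  have hle : ∀ i, ((s i : ℕ) : ℝ) / β ^ (i + 1) ≤ maxDigit β / β * β⁻¹ ^ i := by
    intro i
    have h1 : ((s i : ℕ) : ℝ) ≤ maxDigit β := by exact_mod_cast Nat.lt_succ_iff.1 (s i).2
    calc ((s i : ℕ) : ℝ) / β ^ (i + 1) ≤ maxDigit β / β ^ (i + 1) := by gcongr
      _ = _ := by rw [pow_succ, inv_pow]; field_simp
  have hsum : Summable fun i => ((s i : ℕ) : ℝ) / β ^ (i + 1) :=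
    Summable.of_nonneg_of_le (fun i => by positivity) hle (hgeo.summable.mul_left _)
  unfold proj
  rw [← hsum.sum_add_tsum_nat_add n]
  refine ⟨le_add_of_nonneg_right (tsum_nonneg fun i => by positivity), ?_⟩
  gcongr
  have hgeo' := (hgeo.mul_left ((maxDigit β : ℝ) / β * β⁻¹ ^ n))
  have h2 : (maxDigit β : ℝ) / β * β⁻¹ ^ n * (1 - β⁻¹)⁻¹ = maxDigit β / (β - 1) / β ^ n := by
    have h3 : (1 : ℝ) - β⁻¹ = (β - 1) / β := by field_simp
    have h4 : β - 1 ≠ 0 := by linarith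
    rw [h3, inv_pow]
    field_simp
  rw [← h2, ← hgeo'.tsum_eq]
  refine ((summable_nat_add_iff n).2 hsum).tsum_le_tsum (fun i => ?_) hgeo'.summable
  refine (hle (i + n)).trans_eq ?_
  rw [pow_add]
  ring

/-- A set of sequences of the `β`-shift in which some word of the `β`-shift does not occur projects
onto a set of box dimension less than `1`. -/
theorem exists_isCoveredBy_proj {β : ℝ} (hβ : 1 < β) {S : Set (ℕ → Digit β)}
    (hS : S ⊆ betaShift β) {w : List (Digit β)} (hw : w ∈ words (betaShift β))
    (hwS : w ∉ words S) :
    ∃ s₀ < (1 : ℝ), ∃ C ≥ (0 : ℝ), ∀ δ, 0 < δ → δ ≤ 1 →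
      IsCoveredBy (proj β '' S) (C * δ ^ (-s₀)) δ := by
  classical
  have hβ0 : 0 < β := by linarith
  obtain ⟨s, hs, m₀, hsw⟩ := hw
  obtain ⟨x₁, hx₁, hx₁s⟩ := exists_digitNat_eq_of_mem_betaShift hs (m₀ + w.length)
  obtain ⟨x₀, hx₀⟩ : ∃ x₀, x₀ = (betaMap β)^[m₀] x₁ := ⟨_, rfl⟩
  have hx₀I : x₀ ∈ Ico (0 : ℝ) 1 := hx₀ ▸ iterate_betaMap_mem β hx₁ m₀
  have hx₀w : ∀ (i : ℕ) (hi : i < w.length), digitNat β x₀ i = w[i] := by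
    intro i hi
    rw [hx₀, digitNat_iterate, hx₁s _ (by omega), hsw i hi]
  set L := w.length with hL
  set H := cyl β L x₀ with hH
  have hmiss : ∀ t ∈ S, ∀ n, (fun i : Fin n => (t i : ℕ)) ∈ missingWords β H L n := by
    intro t ht n
    obtain ⟨x, hx, hxt⟩ := exists_digitNat_eq_of_mem_betaShift (hS ht) n
    refine ⟨x, ⟨hx, fun m hm hmem => hwS ⟨t, ht, m, fun i hi => Fin.ext ?_⟩⟩,
      funext fun i => hxt i i.2⟩
    rw [← hxt (m + i) (by omega), ← hx₀w i hi, ← hmem.2 i hi, digitNat_iterate]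
  have hcov : ∀ n, IsCoveredBy (proj β '' S) (missingWords β H L n).ncard
      (maxDigit β / (β - 1) / β ^ n) := by
    intro n
    have hfin := finite_missingWords β H L n
    refine ⟨hfin.toFinset.image fun v => ∑ i : Fin n, (v i : ℝ) / β ^ ((i : ℕ) + 1), ?_, ?_⟩
    · rw [Set.ncard_eq_toFinset_card _ hfin]
      exact_mod_cast Finset.card_image_le
    · rintro _ ⟨t, ht, rfl⟩
      refine ⟨_, Finset.mem_image_of_mem _ (hfin.mem_toFinset.2 (hmiss t ht n)), ?_⟩
      rw [Fin.sum_univ_eq_sum_range (fun i => ((t i : ℕ) : ℝ) / β ^ (i + 1)) n]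
      exact proj_mem_Icc hβ t n
  obtain ⟨q, hq1, hq⟩ := exists_ncard_missingWords_lt hβ hx₀I L
  set b := β ^ q with hb
  have hb1 : 1 < b := one_lt_pow₀ hβ (by omega)
  have hb0 : 0 < b := by linarith
  -- The maximum with `1` makes the logarithm meaningful when no word is left.
  set W : ℝ := max 1 (missingWords β H L q).ncard with hW
  have hW1 : 1 ≤ W := le_max_left _ _
  have hWb : W < b := max_lt hb1 hq
  have hlogb : 0 < Real.log b := Real.log_pos hb1
  set s₀ := Real.log W / Real.log b with hs₀
  have hs₀0 : 0 ≤ s₀ := div_nonneg (Real.log_nonneg hW1) hlogb.le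
  have hWs : W = b ^ s₀ := by
    rw [Real.rpow_def_of_pos hb0, hs₀, mul_div_cancel₀ _ hlogb.ne',
      Real.exp_log (by linarith)]
  -- Words of length `n` give intervals of length `maxDigit β / (β - 1) / β ^ n`; with
  -- `n = q * (j + 1)` this is at most `δ`.
  set A : ℝ := max 1 (maxDigit β / (β - 1)) with hA
  have hA1 : 1 ≤ A := le_max_left _ _
  refine ⟨s₀, by rw [hs₀, div_lt_one hlogb]; exact Real.log_lt_log (by linarith) hWb,
    (b * A) ^ s₀, by positivity, fun δ hδ0 hδ1 => ?_⟩
  have hAδ : 1 ≤ A / δ := by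
    rw [le_div_iff₀ hδ0]
    linarith
  obtain ⟨j, hj1, hj2⟩ := exists_nat_pow_near hAδ hb1
  refine (hcov (q * (j + 1))).mono subset_rfl ?_ ?_
  · calc ((missingWords β H L (q * (j + 1))).ncard : ℝ)
        ≤ ((missingWords β H L q).ncard : ℝ) ^ (j + 1) := by
          exact_mod_cast ncard_missingWords_mul_le β H L q (j + 1)
      _ ≤ W ^ (j + 1) := by
          gcongr
          exact le_max_right _ _
      _ = (b ^ (j + 1)) ^ s₀ := by
          rw [hWs, ← Real.rpow_natCast, ← Real.rpow_natCast, ← Real.rpow_mul hb0.le,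
            ← Real.rpow_mul hb0.le, mul_comm]
      _ ≤ (b * A / δ) ^ s₀ := by
          apply Real.rpow_le_rpow (by positivity) _ hs₀0
          rw [pow_succ', mul_div_assoc]
          gcongr
      _ = (b * A) ^ s₀ * δ ^ (-s₀) := by
          rw [Real.div_rpow (by positivity) hδ0.le, Real.rpow_neg hδ0.le, div_eq_mul_inv]
  · rw [pow_mul, div_le_iff₀ (by positivity)]
    rw [div_lt_iff₀ hδ0] at hj2
    calc (maxDigit β : ℝ) / (β - 1) ≤ A := le_max_right _ _
      _ ≤ δ * b ^ (j + 1) := by linarith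

end BetaShift

end

theorem mainTheorem4 (N : ℕ) (β : Fin N → ℝ) (hβ : ∀ n, 1 < β n)
    (S : (n : Fin N) → Subshift (BetaShift.Digit (β n)) ℕ)
    (hfin : ∀ n, BetaShift.IsFiniteType (S n))
    (hsub : ∀ n, (S n).carrier ⊆ BetaShift.betaShift (β n))
    (hword : ∀ n, ∃ w : List (BetaShift.Digit (β n)),
      w ∈ BetaShift.words (BetaShift.betaShift (β n)) ∧ w ∉ BetaShift.words (S n).carrier) :
    dimH (⋂ n : Fin N,
      BetaShift.avoiding (β n) (BetaShift.proj (β n) '' (S n).carrier)) = 1 := by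
  choose w hw using hword
  exact BetaShift.dimH_iInter_avoiding_eq_one hβ fun n =>
    BetaShift.exists_isCoveredBy_proj (hβ n) (hsub n) (hw n).1 (hw n).2
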